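/- All graphs are finite, simple and undirected. For a graph $G$ and $S\subseteq V(G)$, let $N[S]$ be the set of vertices that lie in $S$ or are adjacent to a vertex of $S$. For a graph $H$, let $\iota(G,H)$ be the minimum cardinality of a set $S\subseteq V(G)$ such that $G-N[S]$ contains no (not necessarily induced) subgraph isomorphic to $H$. Let $B_2$ denote the diamond graph, that is, the complete graph $K_4$ with one edge deleted, and let $Y$ be the $4$-regular graph with vertex set $\mathbb{Z}/9\mathbb{Z}$ in which two vertices are adjacent if and only if they differ by $\pm1$ or $\pm2$ (the square of the cycle $C_9$). Theorem. Let $G$ be a connected graph of order $n$. If $G$ is isomorphic to none of $B_2$, $K_4$ and $Y$, then there is a set $S\subseteq V(G)$ with $|S|\le n/5$ such that $G-N[S]$ contains no subgraph isomorphic to $B_2$; that is, $\iota(G,B_2)\le n/5$. In particular, this holds for every connected graph $G$ of order $n\ge 10$. -/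

import Mathlib

namespace DiamondIsolation

/-- The closed neighbourhood `N[S]` of a set `S` of vertices of `G`: the vertices that lie in `S`
or are adjacent to a vertex of `S`. -/
def closedNeighborhood {V : Type*} (G : SimpleGraph V) (S : Set V) : Set V :=
  {u | u ∈ S ∨ ∃ v ∈ S, G.Adj v u}

/-- `S` is an `H`-isolating set of `G`: the graph `G - N[S]` contains no subgraph (not necessarily
induced) isomorphic to `H`. -/
def IsIsolatingSet {V W : Type*} (G : SimpleGraph V) (H : SimpleGraph W) (S : Set V) : Prop :=
  H.Free (G.induce (closedNeighborhood G S)ᶜ)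

/-- The `H`-isolation number `ι(G, H)` of a finite graph `G`: the minimum cardinality of an
`H`-isolating set of `G`. -/
noncomputable def isolationNumber {V W : Type*} (G : SimpleGraph V) (H : SimpleGraph W) : ℕ :=
  sInf {k : ℕ | ∃ S : Finset V, IsIsolatingSet G H (S : Set V) ∧ S.card = k}

/-- The minimum in the definition of the isolation number is attained. -/
theorem exists_isIsolatingSet_card_eq {V W : Type*} [Fintype V] [Nonempty W]
    (G : SimpleGraph V) (H : SimpleGraph W) :
    ∃ S : Finset V, IsIsolatingSet G H (S : Set V) ∧ S.card = isolationNumber G H := by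
  refine Nat.sInf_mem (s := {k : ℕ | ∃ S : Finset V, IsIsolatingSet G H (S : Set V) ∧ S.card = k})
    ⟨_, Finset.univ, ?_, rfl⟩
  rintro ⟨f⟩
  exact (f (Classical.arbitrary W)).2 (Or.inl (by simp))

/-- The diamond graph `B₂`: the complete graph `K₄` with one edge deleted. -/
def diamond : SimpleGraph (Fin 4) :=
  (⊤ : SimpleGraph (Fin 4)).deleteEdges {s(0, 1)}

/-- The 4-regular graph `Y` on nine vertices, the square of the cycle `C₉`: the vertices are the
residues modulo 9, and two of them are adjacent when they differ by `±1` or `±2`. -/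
def graphY : SimpleGraph (ZMod 9) :=
  SimpleGraph.circulantGraph {1, 2}

end DiamondIsolation

namespace DiamondIsolation

/-! ### Exceptional sets, components and minimal counterexamples inside one ambient graph -/

open Finset
open scoped Classical

variable {V : Type*} {G : SimpleGraph V}

/-! Induced subgraphs are recorded as finsets `A` of one ambient graph, and a vertex-minimal
counterexample is studied. Diamonds need not be induced, so `IsDiamondSet` covers both `B₂` and
`K₄`.

The engine is a count. An exceptional graph has 4 or 9 vertices; once one of its vertices is
dominated from outside, it needs only 0 or 1 vertices of its own. Each exceptional component thus
saves 4 in the balance `5|S| ≤ n`. Hence (`Critical.false_of_linked`) one may delete a set `K` at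
the price of some `T ⊆ K`, where no diamond avoiding `N[T]` meets `K` and `T` reaches every
exceptional component of the rest. This contradicts minimality as soon as `5|T| ≤ |K| + 4k`, where
`k` of these components are counted. With `K = T` a single vertex, it follows that no single vertex
cuts off an exceptional component (`Critical.not_excComp_erase`).

Some vertex has degree at least 4 (`Critical.exists_four_le_card_nbrs`). If `A - N[v]` has `k`
exceptional components, the count gives `deg v ≤ 3 + k`, and the sets of neighbours of `v` linking
them to `v` are disjoint and have size at least 2. Deleting a component with few links must create
an exceptional component through `v`, which rules out `k ≥ 2` (`Critical.excComp_unique`). So all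
degrees are at most 4, and a vertex `v` of degree 4 leaves exactly one exceptional component, a
diamond `H`.

Examining how `H` is attached shows that its two ends are non-adjacent and that each has two private
neighbours in `N(v)`. The whole graph is then a cyclic chain of three diamonds on nine vertices. If
two consecutive middle pairs were not joined by an edge, one vertex would isolate all diamonds. With
three such edges and maximum degree 4 the graph is `Y`, which was excluded (`IsDiamondChain.false`).
-/

/-- `Q` is the vertex set of a (not necessarily induced) diamond of `G`. -/
def IsDiamondSet (G : SimpleGraph V) (Q : Finset V) : Prop :=
  ∃ a b c d, G.Adj a b ∧ G.Adj a c ∧ G.Adj a d ∧ G.Adj b c ∧ G.Adj b d ∧ c ≠ d ∧ Q = {a, b, c, d}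

/-- `B` induces a copy of the graph `Y`. -/
def IsCopyY (G : SimpleGraph V) (B : Finset V) : Prop :=
  ∃ f : ZMod 9 → V, Function.Injective f ∧ univ.image f = B ∧
    ∀ i j, G.Adj (f i) (f j) ↔ graphY.Adj i j

/-- `B` induces one of the exceptional graphs. -/
def Exceptional (G : SimpleGraph V) (B : Finset V) : Prop :=
  IsDiamondSet G B ∨ IsCopyY G B

/-- `v` lies in the closed neighbourhood of `T`. -/
def Covers (G : SimpleGraph V) (T : Finset V) (v : V) : Prop :=
  v ∈ T ∨ ∃ t ∈ T, G.Adj t v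

/-- Every diamond inside `A` meets the closed neighbourhood of `T`. -/
def Isolates (G : SimpleGraph V) (A T : Finset V) : Prop :=
  ∀ Q ⊆ A, IsDiamondSet G Q → ∃ q ∈ Q, Covers G T q

/-- The subgraph induced by `A` has a diamond-isolating set of size at most `|A| / 5`. -/
def Good (G : SimpleGraph V) (A : Finset V) : Prop :=
  ∃ S ⊆ A, 5 * #S ≤ #A ∧ Isolates G A S

/-- `B` is a union of components of the subgraph induced by `R`. -/
def ClosedIn (G : SimpleGraph V) (B R : Finset V) : Prop :=
  B ⊆ R ∧ ∀ b ∈ B, ∀ r ∈ R, G.Adj b r → r ∈ B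

/-- The subgraph induced by `B` is connected. -/
def IsConn (G : SimpleGraph V) (B : Finset V) : Prop :=
  B.Nonempty ∧ ∀ C : Finset V, C.Nonempty → ClosedIn G C B → C = B

/-- `B` is an exceptional component of the subgraph induced by `R`. -/
structure ExcComp (G : SimpleGraph V) (R B : Finset V) : Prop where
  exc : Exceptional G B
  conn : IsConn G B
  closed : ClosedIn G B R

/-- A vertex-minimal counterexample. -/
structure Critical (G : SimpleGraph V) (A : Finset V) : Prop where
  conn : IsConn G A
  not_exc : ¬ Exceptional G A
  not_good : ¬ Good G A
  ind : ∀ C ⊂ A, IsConn G C → Exceptional G C ∨ Good G C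

/-- The neighbours of `v` in `A`. -/
noncomputable def nbrs (G : SimpleGraph V) (A : Finset V) (v : V) : Finset V := A.filter (G.Adj v)

@[simp] theorem mem_nbrs {A : Finset V} {v x : V} : x ∈ nbrs G A v ↔ x ∈ A ∧ G.Adj v x := by
  simp [nbrs]

theorem IsDiamondSet.card {Q : Finset V} (h : IsDiamondSet G Q) : #Q = 4 := by
  obtain ⟨a, b, c, d, h1, h2, h3, h4, h5, h6, rfl⟩ := h
  have := h1.ne; have := h2.ne; have := h3.ne; have := h4.ne; have := h5.ne
  rw [card_insert_of_notMem, card_insert_of_notMem, card_insert_of_notMem, card_singleton] <;>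
    simp_all

theorem IsCopyY.card {B : Finset V} (h : IsCopyY G B) : #B = 9 := by
  obtain ⟨f, hf, rfl, -⟩ := h
  rw [card_image_of_injective _ hf]; rfl

theorem Exceptional.four_le_card {B : Finset V} (h : Exceptional G B) : 4 ≤ #B := by
  rcases h with h | h
  · exact h.card.ge
  · rw [h.card]; norm_num

theorem IsDiamondSet.subset_of_mem {Q B R : Finset V} (h : IsDiamondSet G Q) (hQ : Q ⊆ R)
    (hB : ClosedIn G B R) {q : V} (hq : q ∈ Q) (hqB : q ∈ B) : Q ⊆ B := by
  obtain ⟨a, b, c, d, h1, h2, h3, h4, h5, h6, rfl⟩ := h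
  have ha : a ∈ R := hQ (by simp)
  have hb : b ∈ R := hQ (by simp)
  have hc : c ∈ R := hQ (by simp)
  have hd : d ∈ R := hQ (by simp)
  have key := hB.2
  have haB : a ∈ B := by
    simp only [mem_insert, mem_singleton] at hq
    rcases hq with rfl | rfl | rfl | rfl
    · exact hqB
    · exact key _ hqB _ ha h1.symm
    · exact key _ hqB _ ha h2.symm
    · exact key _ hqB _ ha h3.symm
  have := key _ haB _ hb h1
  have := key _ haB _ hc h2
  have := key _ haB _ hd h3
  intro x hx
  simp only [mem_insert, mem_singleton] at hx
  rcases hx with rfl | rfl | rfl | rfl <;> assumption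

theorem graphY_adj {i j : ZMod 9} :
    graphY.Adj i j ↔ (i - j = 1 ∨ i - j = 2 ∨ j - i = 1 ∨ j - i = 2) := by
  rw [graphY, SimpleGraph.circulantGraph_adj]
  simp only [Set.mem_insert_iff, Set.mem_singleton_iff]
  revert i j; decide

/-- A copy of `Y` may be parametrised so that a given vertex gets the index `0`. -/
theorem IsCopyY.exists_param {B : Finset V} (h : IsCopyY G B) {v : V} (hv : v ∈ B) :
    ∃ f : ZMod 9 → V, Function.Injective f ∧ univ.image f = B ∧ f 0 = v ∧
      ∀ i j, G.Adj (f i) (f j) ↔ (i - j = 1 ∨ i - j = 2 ∨ j - i = 1 ∨ j - i = 2) := by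
  obtain ⟨f, hf, rfl, h⟩ := h
  obtain ⟨k, -, rfl⟩ := mem_image.1 hv
  refine ⟨fun i => f (i + k), fun i j hij => ?_, ?_, by simp, fun i j => ?_⟩
  · simpa using hf hij
  · ext x
    simp only [mem_image, mem_univ, true_and]
    constructor
    · rintro ⟨i, rfl⟩; exact ⟨_, rfl⟩
    · rintro ⟨i, rfl⟩; exact ⟨i - k, by simp⟩
  · rw [h, graphY_adj]; simp

theorem Covers.mono {S T : Finset V} (h : S ⊆ T) {v : V} (hv : Covers G S v) : Covers G T v := by
  rcases hv with hv | ⟨t, ht, hv⟩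
  · exact Or.inl (h hv)
  · exact Or.inr ⟨t, h ht, hv⟩

theorem ClosedIn.eq_of_inter {B C R : Finset V} (hB : IsConn G B) (hC : IsConn G C)
    (hBR : ClosedIn G B R) (hCR : ClosedIn G C R) {x : V} (hxB : x ∈ B) (hxC : x ∈ C) : B = C := by
  have h1 : B ∩ C = B := hB.2 _ ⟨x, by simp [*]⟩
    ⟨inter_subset_left, fun b hb r hr h => by
      simp only [mem_inter] at hb ⊢
      exact ⟨hr, hCR.2 _ hb.2 _ (hBR.1 hr) h⟩⟩
  have h2 : B ∩ C = C := hC.2 _ ⟨x, by simp [*]⟩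
    ⟨inter_subset_right, fun b hb r hr h => by
      simp only [mem_inter] at hb ⊢
      exact ⟨hBR.2 _ hb.1 _ (hCR.1 hr) h, hr⟩⟩
  rw [← h1, h2]

theorem exists_component {R : Finset V} (hR : R.Nonempty) :
    ∃ C, IsConn G C ∧ ClosedIn G C R := by
  obtain ⟨C, hC, hmin⟩ := exists_min_image (R.powerset.filter fun C => C.Nonempty ∧ ClosedIn G C R)
    card ⟨R, mem_filter.2 ⟨by simp, hR, Subset.refl R, fun _ _ _ hr _ => hr⟩⟩
  simp only [mem_filter, mem_powerset] at hC hmin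
  refine ⟨C, ⟨hC.2.1, fun D hD hDC => ?_⟩, hC.2.2⟩
  refine eq_of_subset_of_card_le hDC.1 (hmin D ⟨hDC.1.trans hC.1, hD, hDC.1.trans hC.1, ?_⟩)
  intro b hb r hr h
  exact hDC.2 b hb r (hC.2.2.2 b (hDC.1 hb) r hr h) h

/-! ### The count: every exceptional component saves four -/

/-- An exceptional set with a neighbour `t` is isolated by `t` and few further vertices. -/
theorem Exceptional.exists_isolates {B T : Finset V} (h : Exceptional G B)
    (hT : ∃ t ∈ T, ∃ b ∈ B, G.Adj t b) :
    ∃ S ⊆ B, 5 * #S + 4 ≤ #B ∧ Isolates G B (T ∪ S) := by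
  obtain ⟨t, ht, b, hb, htb⟩ := hT
  rcases h with h | h
  · refine ⟨∅, by simp, by simp [h.card], fun Q hQ hQd => ⟨b, ?_, Or.inr ⟨t, by simp [ht], htb⟩⟩⟩
    rwa [eq_of_subset_of_card_le hQ (by rw [h.card, hQd.card])]
  · have hc := h.card
    obtain ⟨f, hf, rfl, rfl, hadj⟩ := h.exists_param hb
    -- The vertex `0` is dominated by `t`, and `4` covers `2, …, 6`. Only `1, 7, 8` can stay
    -- uncovered, too few for a diamond.
    refine ⟨{f 4}, by simp, by simp [hc], fun Q hQ hQd => ?_⟩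
    by_contra! hcon
    have hsub : Q ⊆ ({1, 7, 8} : Finset (ZMod 9)).image f := by
      intro q hq
      obtain ⟨i, -, rfl⟩ := mem_image.1 (hQ hq)
      have h1 := hcon _ hq
      have h2 : i ≠ 0 := by
        rintro rfl
        exact h1 (Or.inr ⟨t, by simp [ht], htb⟩)
      have h3 : i ≠ 4 := by
        rintro rfl
        exact h1 (Or.inl (by simp))
      have h4 : ¬ G.Adj (f 4) (f i) := fun h => h1 (Or.inr ⟨f 4, by simp, h⟩)
      rw [hadj] at h4
      refine mem_image_of_mem _ ?_
      clear hq h1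
      revert i; decide
    have := (card_le_card hsub).trans card_image_le
    rw [hQd.card] at this
    revert this; decide

/-- The components are treated independently: a good one pays for itself and an exceptional one
saves 4. Counting only a chosen family `F` of exceptional components avoids having to enumerate them
all. -/
theorem exists_isolates_of_components {T : Finset V} (R : Finset V)
    (ind : ∀ C ⊆ R, IsConn G C → Exceptional G C ∨ Good G C)
    (hT : ∀ B, ExcComp G R B → ∃ t ∈ T, ∃ b ∈ B, G.Adj t b)
    (F : Finset (Finset V)) (hF : ∀ B ∈ F, ExcComp G R B) :
    ∃ S ⊆ R, 5 * #S + 4 * #F ≤ #R ∧ Isolates G R (T ∪ S) := by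
  induction R using Finset.strongInduction generalizing F with
  | H R ih =>
  rcases R.eq_empty_or_nonempty with rfl | hR
  · have : F = ∅ := by
      by_contra hne
      obtain ⟨B, hB⟩ := nonempty_iff_ne_empty.2 hne
      have h1 := (hF B hB).conn.1
      have h2 := (hF B hB).closed.1
      simp_all
    subst this
    refine ⟨∅, by simp, by simp, fun Q hQ hQd => ?_⟩
    have := hQd.card
    simp_all
  obtain ⟨C, hC, hCR⟩ := exists_component (G := G) hR
  have hlift : ∀ B, ClosedIn G B (R \ C) → ClosedIn G B R := fun B hB =>
    ⟨hB.1.trans sdiff_subset, fun b hb r hr h => hB.2 b hb r (by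
      have := mem_sdiff.1 (hB.1 hb)
      exact mem_sdiff.2 ⟨hr, fun hrC => this.2 (hCR.2 r hrC b this.1 h.symm)⟩) h⟩
  have hF' : ∀ B ∈ F.erase C, ExcComp G (R \ C) B := by
    intro B hB
    obtain ⟨hne, hB⟩ := mem_erase.1 hB
    obtain ⟨h1, h2, h3⟩ := hF B hB
    refine ⟨h1, h2, fun b hb => mem_sdiff.2 ⟨h3.1 hb, fun hbC => hne ?_⟩, fun b hb r hr h =>
      h3.2 b hb r (mem_sdiff.1 hr).1 h⟩
    exact ClosedIn.eq_of_inter h2 hC h3 hCR hb hbC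
  obtain ⟨S, hS, hcard, hiso⟩ := ih (R \ C)
    (sdiff_ssubset hCR.1 hC.1) (fun D hD => ind D (hD.trans sdiff_subset))
    (fun B hB => hT B ⟨hB.exc, hB.conn, hlift B hB.closed⟩) _ hF'
  have hRC : #(R \ C) + #C = #R := card_sdiff_add_card_eq_card hCR.1
  -- The truncated difference `#F - #(F.erase C)` is 1 if `C ∈ F` and 0 otherwise.
  have hCS : ∃ S' ⊆ C, 5 * #S' + 4 * (#F - #(F.erase C)) ≤ #C ∧ Isolates G C (T ∪ S') := by
    by_cases hex : Exceptional G C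
    · obtain ⟨S', h1, h2, h3⟩ := hex.exists_isolates (hT C ⟨hex, hC, hCR⟩)
      have := pred_card_le_card_erase (s := F) (a := C)
      exact ⟨S', h1, by omega, h3⟩
    · obtain ⟨S', h1, h2, h3⟩ := (ind C hCR.1 hC).resolve_left hex
      have : C ∉ F := fun h => hex (hF C h).exc
      refine ⟨S', h1, by rw [erase_eq_of_notMem this]; omega, fun Q hQ hQd => ?_⟩
      obtain ⟨q, hq, hqc⟩ := h3 Q hQ hQd
      exact ⟨q, hq, hqc.mono subset_union_right⟩
  obtain ⟨S', h1, h2, h3⟩ := hCS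
  have hle := card_le_card (erase_subset C F)
  refine ⟨S ∪ S', union_subset (hS.trans sdiff_subset) (h1.trans hCR.1), ?_, ?_⟩
  · have := card_union_le S S'
    omega
  · intro Q hQ hQd
    by_cases hex : ∃ q ∈ Q, q ∈ C
    · obtain ⟨q, hq, hqC⟩ := hex
      obtain ⟨p, hp, hpc⟩ := h3 Q (hQd.subset_of_mem hQ hCR hq hqC) hQd
      exact ⟨p, hp, hpc.mono (by grind)⟩
    · push Not at hex
      obtain ⟨p, hp, hpc⟩ := hiso Q (fun q hq => mem_sdiff.2 ⟨hQ hq, hex q hq⟩) hQd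
      exact ⟨p, hp, hpc.mono (by grind)⟩

/-- The source of every contradiction below: `T` handles the diamonds meeting `K`, and minimality
applies to the components of `A \ K`. Their combined cost stays within `|A| / 5`. -/
theorem Critical.false_of_linked {A K T : Finset V} (hA : Critical G A) (hK : K ⊆ A) (hTK : T ⊆ K)
    (hT : T.Nonempty)
    (hdia : ∀ Q ⊆ A, IsDiamondSet G Q → (∀ q ∈ Q, ¬ Covers G T q) → Disjoint Q K)
    (hlink : ∀ B, ExcComp G (A \ K) B → ∃ t ∈ T, ∃ b ∈ B, G.Adj t b)
    (F : Finset (Finset V)) (hF : ∀ B ∈ F, ExcComp G (A \ K) B)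
    (hcard : 5 * #T ≤ #K + 4 * #F) : False := by
  have hss : A \ K ⊂ A := sdiff_ssubset hK (hT.mono hTK)
  obtain ⟨S, hS, h1, h2⟩ := exists_isolates_of_components (A \ K)
    (fun C hC => hA.ind C (lt_of_le_of_lt hC hss)) hlink F hF
  refine hA.not_good ⟨T ∪ S, union_subset (hTK.trans hK) (hS.trans sdiff_subset), ?_, ?_⟩
  · have := card_union_le T S
    have : #(A \ K) + #K = #A := card_sdiff_add_card_eq_card hK
    omega
  · intro Q hQ hQd
    by_contra! hcon
    have hd := hdia Q hQ hQd fun q hq h => hcon q hq (h.mono subset_union_left)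
    obtain ⟨q, hq, h⟩ := h2 Q (fun q hq => mem_sdiff.2 ⟨hQ hq, disjoint_left.1 hd hq⟩) hQd
    exact hcon q hq h

/-- If `T` is already paid for by `K`, the linking condition must fail, so there is an exceptional
component to violate it. -/
theorem Critical.exists_excComp {A K T : Finset V} (hA : Critical G A) (hK : K ⊆ A) (hTK : T ⊆ K)
    (hT : T.Nonempty)
    (hdia : ∀ Q ⊆ A, IsDiamondSet G Q → (∀ q ∈ Q, ¬ Covers G T q) → Disjoint Q K)
    (hcard : 5 * #T ≤ #K) : ∃ B, ExcComp G (A \ K) B := by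
  by_contra! h
  exact hA.false_of_linked hK hTK hT hdia (fun B hB => (h B hB).elim) ∅ (by simp) (by simpa)

/-- A connected set has an edge leaving each proper nonempty subset. -/
theorem IsConn.exists_adj {A B : Finset V} (hA : IsConn G A) (hB : B.Nonempty) (hBA : B ⊂ A) :
    ∃ b ∈ B, ∃ r ∈ A, r ∉ B ∧ G.Adj b r := by
  by_contra! h
  exact hBA.ne (hA.2 B hB ⟨hBA.1, fun b hb r hr hbr => by_contra fun hr' => h b hb r hr hr' hbr⟩)

/-- Deleting one vertex from a minimal counterexample leaves no exceptional component. -/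
theorem Critical.not_excComp_erase {A : Finset V} (hA : Critical G A) {x : V} (hx : x ∈ A)
    (B : Finset V) : ¬ ExcComp G (A \ {x}) B := by
  intro hB
  -- The balance is tight: `5 ≤ 1 + 4`, one vertex deleted and one exceptional component saved.
  refine hA.false_of_linked (K := {x}) (T := {x}) (by simpa) (by simp) (by simp) ?_ ?_ {B}
    (by simpa) (by simp)
  · intro Q _ _ hq
    simp only [disjoint_singleton_right]
    intro h
    exact hq x h (Or.inl (by simp))
  · intro B hB
    have hxB : x ∉ B := fun h => by simpa using hB.closed.1 h
    obtain ⟨b, hb, r, hr, hrB, h⟩ := hA.conn.exists_adj hB.conn.1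
      (ssubset_of_subset_of_ne (hB.closed.1.trans sdiff_subset) (by rintro rfl; exact hxB hx))
    refine ⟨x, by simp, b, hb, ?_⟩
    have : r = x := by
      by_contra hne
      exact hrB (hB.closed.2 b hb r (by simp [hr, hne]) h)
    exact this ▸ h.symm

/-! ### Local tools: pendant vertices and complete lists of neighbours -/

theorem IsDiamondSet.exists_two_adj {Q : Finset V} (h : IsDiamondSet G Q) {q : V} (hq : q ∈ Q) :
    ∃ p ∈ Q, ∃ r ∈ Q, p ≠ r ∧ G.Adj q p ∧ G.Adj q r := by
  obtain ⟨a, b, c, d, h1, h2, h3, h4, h5, h6, rfl⟩ := h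
  simp only [mem_insert, mem_singleton] at hq
  rcases hq with rfl | rfl | rfl | rfl
  · exact ⟨c, by simp, d, by simp, h6, h2, h3⟩
  · exact ⟨c, by simp, d, by simp, h6, h4, h5⟩
  · exact ⟨a, by simp, b, by simp, h1.ne, h2.symm, h4.symm⟩
  · exact ⟨a, by simp, b, by simp, h1.ne, h3.symm, h5.symm⟩

/-- A diamond avoids vertices that have at most one neighbour outside the closed neighbourhood
of `T`. -/
theorem disjoint_of_pendant {A K T : Finset V}
    (h : ∀ u ∈ K, ¬ Covers G T u → ∀ p ∈ A, ∀ q ∈ A, ¬ Covers G T p → ¬ Covers G T q →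
      G.Adj u p → G.Adj u q → p = q) :
    ∀ Q ⊆ A, IsDiamondSet G Q → (∀ q ∈ Q, ¬ Covers G T q) → Disjoint Q K := by
  intro Q hQ hQd hq
  rw [disjoint_left]
  intro u hu huK
  obtain ⟨p, hp, r, hr, hne, h1, h2⟩ := hQd.exists_two_adj hu
  exact hne (h u huK (hq u hu) p (hQ hp) r (hQ hr) (hq p hp) (hq r hr) h1 h2)

theorem Critical.exists_isDiamondSet {A : Finset V} (hA : Critical G A) :
    ∃ Q ⊆ A, IsDiamondSet G Q := by
  by_contra! h
  exact hA.not_good ⟨∅, by simp, by simp, fun Q hQ hQd => (h Q hQ hQd).elim⟩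

theorem covers_singleton {t v : V} : Covers G {t} v ↔ v = t ∨ G.Adj t v := by
  simp [Covers]

theorem IsDiamondSet.of_adj {a b c d : V} (h1 : G.Adj a b) (h2 : G.Adj a c) (h3 : G.Adj a d)
    (h4 : G.Adj b c) (h5 : G.Adj b d) (h6 : c ≠ d) : IsDiamondSet G {a, b, c, d} :=
  ⟨a, b, c, d, h1, h2, h3, h4, h5, h6, rfl⟩

theorem nbrs_eq_of_card_le {A S : Finset V} {v : V} {k : ℕ} (h : #(nbrs G A v) ≤ k)
    (hS : S ⊆ nbrs G A v) (hk : k ≤ #S) {u : V} (hu : u ∈ A) (hvu : G.Adj v u) : u ∈ S := by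
  rw [eq_of_subset_of_card_le hS (h.trans hk)]
  simp [hu, hvu]

theorem eq_of_adj_of_card_le_three {A : Finset V} {v p q r : V} (h : #(nbrs G A v) ≤ 3)
    (hp : p ∈ A ∧ G.Adj v p) (hq : q ∈ A ∧ G.Adj v q) (hr : r ∈ A ∧ G.Adj v r)
    (hpq : p ≠ q) (hpr : p ≠ r) (hqr : q ≠ r) : ∀ u ∈ A, G.Adj v u → u = p ∨ u = q ∨ u = r := by
  intro u hu hvu
  have := nbrs_eq_of_card_le (S := {p, q, r}) h (by simp [insert_subset_iff, *])
    (by rw [card_insert_of_notMem (by simp [*]), card_insert_of_notMem (by simp [*]),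
      card_singleton]) hu hvu
  simpa using this

theorem eq_of_adj_of_card_le_four {A : Finset V} {v p q r s : V} (h : #(nbrs G A v) ≤ 4)
    (hp : p ∈ A ∧ G.Adj v p) (hq : q ∈ A ∧ G.Adj v q) (hr : r ∈ A ∧ G.Adj v r)
    (hs : s ∈ A ∧ G.Adj v s) (hpq : p ≠ q) (hpr : p ≠ r) (hps : p ≠ s) (hqr : q ≠ r) (hqs : q ≠ s)
    (hrs : r ≠ s) : ∀ u ∈ A, G.Adj v u → u = p ∨ u = q ∨ u = r ∨ u = s := by
  intro u hu hvu
  have := nbrs_eq_of_card_le (S := {p, q, r, s}) h (by simp [insert_subset_iff, *])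
    (by rw [card_insert_of_notMem (by simp [*]), card_insert_of_notMem (by simp [*]),
      card_insert_of_notMem (by simp [*]), card_singleton]) hu hvu
  simpa using this

/-- A copy of `Y` is 4-regular. -/
theorem IsCopyY.card_nbrs {B : Finset V} (h : IsCopyY G B) {v : V} (hv : v ∈ B) :
    #(nbrs G B v) = 4 := by
  obtain ⟨f, hf, rfl, rfl, hadj⟩ := h.exists_param hv
  have : nbrs G (univ.image f) (f 0) = ({1, 2, 7, 8} : Finset (ZMod 9)).image f := by
    ext x
    simp only [mem_nbrs, mem_image, mem_univ, true_and]
    constructor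
    · rintro ⟨⟨i, rfl⟩, h⟩
      rw [hadj] at h
      refine ⟨i, ?_, rfl⟩
      revert i; decide
    · rintro ⟨i, hi, rfl⟩
      refine ⟨⟨i, rfl⟩, ?_⟩
      rw [hadj]
      revert i; decide
  rw [this, card_image_of_injective _ hf]
  rfl

theorem nbrs_mono {A B : Finset V} (h : A ⊆ B) (v : V) : nbrs G A v ⊆ nbrs G B v :=
  filter_subset_filter _ h

/-! ### Minimal counterexamples have a vertex of degree at least four -/

/-- Two diamonds joined by an edge `d y` and a common neighbour `x`, in a graph where the first one
has no further outgoing edges: no diamond avoiding `N[x]` meets them. -/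
theorem disjoint_of_linked_diamonds {A B : Finset V} {a b c d x y p : V}
    (na : ∀ u ∈ A, G.Adj a u → u = b ∨ u = c ∨ u = d)
    (nb : ∀ u ∈ A, G.Adj b u → u = a ∨ u = c ∨ u = d)
    (nd : ∀ u ∈ A, G.Adj d u → u = a ∨ u = b ∨ u = y) (haB : a ∉ B) (hbB : b ∉ B)
    (hcx : G.Adj c x) (hBd : IsDiamondSet G B)
    (hout : ∀ u ∈ B, ∀ r ∈ A, r ∉ B → G.Adj u r → r = d ∨ r = x) (hp : p ∈ B)
    (hpx : G.Adj p x) :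
    ∀ Q ⊆ A, IsDiamondSet G Q → (∀ q ∈ Q, ¬ Covers G {x} q) →
      Disjoint Q ({a, b, c, d, x} ∪ B) := by
  intro Q hQ hQd hq
  obtain ⟨m, n, r, s, hmn, hmr, hms, hnr, hns, hrs, rfl⟩ := id hQd
  have hcov : ∀ u, u ∈ ({m, n, r, s} : Finset V) → u ≠ x ∧ ¬ G.Adj x u := by
    intro u hu
    have := hq u hu
    rw [covers_singleton] at this
    tauto
  have hnc : ∀ u, u ∈ ({m, n, r, s} : Finset V) → u ≠ c := by
    rintro u hu rfl
    exact (hcov u hu).2 hcx.symm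
  have hm := hnc m (by simp)
  have hn := hnc n (by simp)
  have hr := hnc r (by simp)
  have hs := hnc s (by simp)
  have hmA := hQ (show m ∈ _ by simp)
  have hnA := hQ (show n ∈ _ by simp)
  have hrA := hQ (show r ∈ _ by simp)
  have hsA := hQ (show s ∈ _ by simp)
  -- A hub of a diamond has three neighbours in it. Since `c` is covered by `x`, only two uncovered
  -- neighbours remain for `a` and for `b`, so neither is a hub; `key'` then excludes them as ends.
  have key : ∀ p q r u v w : V, p ≠ q → p ≠ r → q ≠ r → p ≠ v → q ≠ v → r ≠ v →
      (p = u ∨ p = v ∨ p = w) → (q = u ∨ q = v ∨ q = w) → (r = u ∨ r = v ∨ r = w) → False := by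
    clear * -
    rintro p q r u v w h1 h2 h3 h4 h5 h6 (rfl | rfl | rfl) (rfl | rfl | rfl) (rfl | rfl | rfl) <;>
      contradiction
  have hma : m ≠ a := by
    rintro rfl
    exact key n r s _ c _ hnr.ne hns.ne hrs hn hr hs (na n hnA hmn) (na r hrA hmr) (na s hsA hms)
  have hmb : m ≠ b := by
    rintro rfl
    exact key n r s _ c _ hnr.ne hns.ne hrs hn hr hs (nb n hnA hmn) (nb r hrA hmr) (nb s hsA hms)
  have hna : n ≠ a := by
    rintro rfl
    exact key m r s _ c _ hmr.ne hms.ne hrs hm hr hs (na m hmA hmn.symm) (na r hrA hnr)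
      (na s hsA hns)
  have hnb : n ≠ b := by
    rintro rfl
    exact key m r s _ c _ hmr.ne hms.ne hrs hm hr hs (nb m hmA hmn.symm) (nb r hrA hnr)
      (nb s hsA hns)
  have key' : ∀ p q u v w : V, p ≠ q → p ≠ u → q ≠ u → p ≠ v → q ≠ v →
      (p = u ∨ p = v ∨ p = w) → (q = u ∨ q = v ∨ q = w) → False := by
    clear * -
    rintro p q u v w h1 h2 h3 h4 h5 (rfl | rfl | rfl) (rfl | rfl | rfl) <;> contradiction
  have hra : r ≠ a := by
    rintro rfl
    exact key' m n _ _ _ hmn.ne hmb hnb hm hn (na m hmA hmr.symm) (na n hnA hnr.symm)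
  have hrb : r ≠ b := by
    rintro rfl
    exact key' m n _ _ _ hmn.ne hma hna hm hn (nb m hmA hmr.symm) (nb n hnA hnr.symm)
  have hsa : s ≠ a := by
    rintro rfl
    exact key' m n _ _ _ hmn.ne hmb hnb hm hn (na m hmA hms.symm) (na n hnA hns.symm)
  have hsb : s ≠ b := by
    rintro rfl
    exact key' m n _ _ _ hmn.ne hma hna hm hn (nb m hmA hms.symm) (nb n hnA hns.symm)
  -- With `a` and `b` excluded, `d` has only `y` left, while every vertex of a diamond has two
  -- neighbours in it.
  have hmd : m ≠ d := by
    rintro rfl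
    exact key' n r _ _ _ hnr.ne hna hra hnb hrb (nd n hnA hmn) (nd r hrA hmr)
  have hnd : n ≠ d := by
    rintro rfl
    exact key' m r _ _ _ hmr.ne hma hra hmb hrb (nd m hmA hmn.symm) (nd r hrA hnr)
  have hrd : r ≠ d := by
    rintro rfl
    exact key' m n _ _ _ hmn.ne hma hna hmb hnb (nd m hmA hmr.symm) (nd n hnA hnr.symm)
  have hsd : s ≠ d := by
    rintro rfl
    exact key' m n _ _ _ hmn.ne hma hna hmb hnb (nd m hmA hms.symm) (nd n hnA hns.symm)
  have hQ' : ∀ u, u ∈ ({m, n, r, s} : Finset V) → u ≠ a ∧ u ≠ b ∧ u ≠ c ∧ u ≠ d := by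
    intro u hu
    simp only [mem_insert, mem_singleton] at hu
    rcases hu with rfl | rfl | rfl | rfl
    · exact ⟨hma, hmb, hm, hmd⟩
    · exact ⟨hna, hnb, hn, hnd⟩
    · exact ⟨hra, hrb, hr, hrd⟩
    · exact ⟨hsa, hsb, hs, hsd⟩
  rw [disjoint_right]
  intro u hu huQ
  have huB : u ∈ B := by
    have h1 := hcov u huQ
    have h2 := hQ' u huQ
    simp only [mem_union, mem_insert, mem_singleton] at hu
    tauto
  have hsub : ({m, n, r, s} : Finset V) ⊆ B := by
    refine hQd.subset_of_mem (R := {m, n, r, s} ∪ B) subset_union_left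
      ⟨subset_union_right, fun w hw z hz hwz => ?_⟩ huQ huB
    by_contra hzB
    have hz' : z ∈ ({m, n, r, s} : Finset V) := by
      rcases mem_union.1 hz with h | h
      · exact h
      · exact (hzB h).elim
    have h1 := hout w hw z (hQ hz') hzB hwz
    have h2 := hcov z hz'
    have h3 := hQ' z hz'
    tauto
  have := eq_of_subset_of_card_le hsub (by rw [hBd.card, hQd.card])
  rw [← this] at hp
  exact (hcov p hp).2 hpx.symm

/-- With all degrees at most 3, deleting `{a, b, c, d, x}` at the price of `c` leaves an exceptional
component `B`, attached only through `d` and `x`, and through both. Deleting `B` as well, now at the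
price of `x`, leaves an exceptional component that `x` alone separates, which is impossible. -/
theorem Critical.false_of_cubic_of_adj {A : Finset V} (hA : Critical G A)
    (hdeg : ∀ v ∈ A, #(nbrs G A v) ≤ 3) {a b c d x : V} (hab : G.Adj a b) (hac : G.Adj a c)
    (had : G.Adj a d) (hbc : G.Adj b c) (hbd : G.Adj b d) (hcd : c ≠ d) (ha : a ∈ A) (hb : b ∈ A)
    (hc : c ∈ A) (hd : d ∈ A) (hx : x ∈ A) (hxa : x ≠ a) (hxb : x ≠ b) (hxd : x ≠ d)
    (hcx : G.Adj c x) : False := by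
  have na := eq_of_adj_of_card_le_three (hdeg a ha) ⟨hb, hab⟩ ⟨hc, hac⟩ ⟨hd, had⟩ hbc.ne hbd.ne hcd
  have nb := eq_of_adj_of_card_le_three (hdeg b hb) ⟨ha, hab.symm⟩ ⟨hc, hbc⟩ ⟨hd, hbd⟩
    hac.ne had.ne hcd
  have nc := eq_of_adj_of_card_le_three (hdeg c hc) ⟨ha, hac.symm⟩ ⟨hb, hbc.symm⟩ ⟨hx, hcx⟩
    hab.ne hxa.symm hxb.symm
  have hKA : ({a, b, c, d, x} : Finset V) ⊆ A := by simp [insert_subset_iff, *]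
  have hcard : #({a, b, c, d, x} : Finset V) = 5 := by
    rw [card_insert_of_notMem, card_insert_of_notMem, card_insert_of_notMem, card_insert_of_notMem,
      card_singleton] <;> simp [hab.ne, hac.ne, had.ne, hbc.ne, hbd.ne, hcd, hcx.ne, hxa.symm,
        hxb.symm, hxd.symm]
  obtain ⟨B, hB⟩ := hA.exists_excComp (T := {c}) hKA (by simp) (by simp)
    (disjoint_of_pendant (by
      intro u hu huc p hp q hq hpc hqc hup huq
      rw [covers_singleton] at *
      push Not at huc hpc hqc
      have hud : u = d := by
        simp only [mem_insert, mem_singleton] at hu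
        rcases hu with rfl | rfl | rfl | rfl | rfl
        · exact (huc.2 hac.symm).elim
        · exact (huc.2 hbc.symm).elim
        · exact (huc.1 rfl).elim
        · rfl
        · exact (huc.2 hcx).elim
      subst hud
      by_contra hpq
      have := eq_of_adj_of_card_le_three (hdeg u hd) ⟨ha, had.symm⟩ ⟨hb, hbd.symm⟩ ⟨hp, hup⟩
        hab.ne (by rintro rfl; exact hpc.2 hac.symm) (by rintro rfl; exact hpc.2 hbc.symm) q hq huq
      rcases this with rfl | rfl | rfl
      · exact hqc.2 hac.symm
      · exact hqc.2 hbc.symm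
      · exact hpq rfl))
    (by rw [hcard]; simp)
  have hBA : ∀ u ∈ B, u ∈ A ∧ u ≠ a ∧ u ≠ b ∧ u ≠ c ∧ u ≠ d ∧ u ≠ x := by
    intro u hu
    simpa using hB.closed.1 hu
  have hout : ∀ u ∈ B, ∀ r ∈ A, r ∉ B → G.Adj u r → r = d ∨ r = x := by
    intro u hu r hr hrB hur
    have h1 := hBA u hu
    by_contra hcon
    push Not at hcon
    have h2 : r ≠ a := by
      rintro rfl; exact (na u h1.1 hur.symm).elim h1.2.2.1 (Or.elim · h1.2.2.2.1 h1.2.2.2.2.1)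
    have h3 : r ≠ b := by
      rintro rfl; exact (nb u h1.1 hur.symm).elim h1.2.1 (Or.elim · h1.2.2.2.1 h1.2.2.2.2.1)
    have h4 : r ≠ c := by
      rintro rfl; exact (nc u h1.1 hur.symm).elim h1.2.1 (Or.elim · h1.2.2.1 h1.2.2.2.2.2)
    exact hrB (hB.closed.2 u hu r (by simp [*]) hur)
  have hlink : ∀ z w, z ∈ A → z ∉ B → (∀ r, r = d ∨ r = x → r = z ∨ r = w) →
      ∃ y ∈ B, G.Adj y w := by
    intro z w hz hzB hzw
    by_contra! hcon
    refine hA.not_excComp_erase hz B ⟨hB.exc, hB.conn, fun u hu => ?_, fun u hu r hr hur => ?_⟩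
    · simp only [mem_sdiff, mem_singleton]
      exact ⟨(hBA u hu).1, fun h => hzB (h ▸ hu)⟩
    · simp only [mem_sdiff, mem_singleton] at hr
      by_contra hrB
      rcases hzw r (hout u hu r hr.1 hrB hur) with h | h
      · exact hr.2 h
      · exact hcon u hu (h ▸ hur)
  have hxB : x ∉ B := fun h => (hBA x h).2.2.2.2.2 rfl
  have hdB : d ∉ B := fun h => (hBA d h).2.2.2.2.1 rfl
  obtain ⟨y, hy, hyd⟩ := hlink x d hx hxB (by tauto)
  obtain ⟨p, hp, hpx⟩ := hlink d x hd hdB (by tauto)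
  have hy' := hBA y hy
  have nd := eq_of_adj_of_card_le_three (hdeg d hd) ⟨ha, had.symm⟩ ⟨hb, hbd.symm⟩
    ⟨hy'.1, hyd.symm⟩ hab.ne hy'.2.1.symm hy'.2.2.1.symm
  -- A copy of `Y` is 4-regular, too much for degree at most 3.
  have hBd : IsDiamondSet G B := by
    rcases hB.exc with h | h
    · exact h
    · have := h.card_nbrs hp
      have := card_le_card (nbrs_mono (G := G) (hB.closed.1.trans sdiff_subset) p)
      have := hdeg p (hBA p hp).1
      omega
  obtain ⟨P, hP⟩ := hA.exists_excComp (T := {x}) (K := {a, b, c, d, x} ∪ B)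
    (union_subset hKA (hB.closed.1.trans sdiff_subset)) (by simp) (by simp)
    (disjoint_of_linked_diamonds na nb nd (fun h => (hBA a h).2.1 rfl) (fun h => (hBA b h).2.2.1 rfl)
      hcx hBd hout hp hpx)
    (by
      have := card_le_card (subset_union_left (s₁ := ({a, b, c, d, x} : Finset V)) (s₂ := B))
      rw [hcard] at this
      simpa using this)
  refine hA.not_excComp_erase hx P ⟨hP.exc, hP.conn, fun u hu => ?_, fun u hu r hr hur => ?_⟩
  · have := hP.closed.1 hu
    simp only [mem_sdiff, mem_union, mem_insert, mem_singleton] at this ⊢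
    tauto
  · have hu' := hP.closed.1 hu
    refine hP.closed.2 u hu r ?_ hur
    simp only [mem_sdiff, mem_union, mem_insert, mem_singleton, not_or] at hr hu' ⊢
    obtain ⟨huA, ⟨ua, ub, uc, ud, ux⟩, uB⟩ := hu'
    have hrB : r ∉ B := fun h => (hout r h u huA uB hur.symm).elim ud ux
    have hyP : u ≠ y := by rintro rfl; exact uB hy
    refine ⟨hr.1, ⟨?_, ?_, ?_, ?_, hr.2⟩, hrB⟩
    · rintro rfl; exact (na u huA hur.symm).elim ub (Or.elim · uc ud)
    · rintro rfl; exact (nb u huA hur.symm).elim ua (Or.elim · uc ud)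
    · rintro rfl; exact (nc u huA hur.symm).elim ua (Or.elim · ub ux)
    · rintro rfl; exact (nd u huA hur.symm).elim ua (Or.elim · ub hyP)

/-- A minimal counterexample has a vertex of degree at least four. -/
theorem Critical.exists_four_le_card_nbrs {A : Finset V} (hA : Critical G A) :
    ∃ v ∈ A, 4 ≤ #(nbrs G A v) := by
  by_contra! hcon
  have hdeg : ∀ v ∈ A, #(nbrs G A v) ≤ 3 := fun v hv => by have := hcon v hv; omega
  obtain ⟨Q, hQA, hQ⟩ := hA.exists_isDiamondSet
  have hne : Q ≠ A := by rintro rfl; exact hA.not_exc (Or.inl hQ)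
  obtain ⟨u, hu, x, hx, hxQ, hux⟩ :=
    hA.conn.exists_adj (card_pos.1 (by rw [hQ.card]; norm_num)) (ssubset_of_subset_of_ne hQA hne)
  obtain ⟨a, b, c, d, hab, hac, had, hbc, hbd, hcd, rfl⟩ := id hQ
  have ha : a ∈ A := hQA (by simp)
  have hb : b ∈ A := hQA (by simp)
  have hc : c ∈ A := hQA (by simp)
  have hd : d ∈ A := hQA (by simp)
  have na := eq_of_adj_of_card_le_three (hdeg a ha) ⟨hb, hab⟩ ⟨hc, hac⟩ ⟨hd, had⟩ hbc.ne hbd.ne hcd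
  have nb := eq_of_adj_of_card_le_three (hdeg b hb) ⟨ha, hab.symm⟩ ⟨hc, hbc⟩ ⟨hd, hbd⟩
    hac.ne had.ne hcd
  simp only [mem_insert, mem_singleton, not_or] at hu hxQ
  obtain ⟨h1, h2, h3, h4⟩ := hxQ
  rcases hu with rfl | rfl | rfl | rfl
  · have := na x hx hux; tauto
  · have := nb x hx hux; tauto
  · exact hA.false_of_cubic_of_adj hdeg hab hac had hbc hbd hcd ha hb hc hd hx h1 h2 h4 hux
  · exact hA.false_of_cubic_of_adj hdeg hab had hac hbd hbc hcd.symm ha hb hd hc hx h1 h2 h3 hux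

/-! ### Exceptional components of `A - N[v]` and their links to `v` -/

/-- The closed neighbourhood of `v` in `A`. -/
noncomputable def closedNbrs (G : SimpleGraph V) (A : Finset V) (v : V) : Finset V :=
  insert v (nbrs G A v)

@[simp] theorem mem_closedNbrs {A : Finset V} {v x : V} :
    x ∈ closedNbrs G A v ↔ x = v ∨ x ∈ A ∧ G.Adj v x := by
  simp [closedNbrs]

/-- The neighbours of `v` in `A` that have a neighbour in `B`. -/
noncomputable def links (G : SimpleGraph V) (A : Finset V) (v : V) (B : Finset V) : Finset V :=
  (nbrs G A v).filter fun x => ∃ b ∈ B, G.Adj x b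

@[simp] theorem mem_links {A B : Finset V} {v x : V} :
    x ∈ links G A v B ↔ (x ∈ A ∧ G.Adj v x) ∧ ∃ b ∈ B, G.Adj x b := by
  simp [links]

theorem links_subset {A B : Finset V} {v : V} : links G A v B ⊆ nbrs G A v := filter_subset _ _

theorem card_closedNbrs {A : Finset V} {v : V} : #(closedNbrs G A v) = #(nbrs G A v) + 1 := by
  rw [closedNbrs, card_insert_of_notMem (by simp)]

theorem closedNbrs_subset {A : Finset V} {v : V} (hv : v ∈ A) : closedNbrs G A v ⊆ A := by
  intro x hx
  rcases mem_closedNbrs.1 hx with rfl | hx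
  · exact hv
  · exact hx.1

/-- A neighbour of a component of `A - N[v]` lies in the component or links it to `v`. -/
theorem ClosedIn.mem_or_mem_links {A B : Finset V} {v : V}
    (hB : ClosedIn G B (A \ closedNbrs G A v)) {b r : V} (hb : b ∈ B) (hr : r ∈ A)
    (h : G.Adj b r) : r ∈ B ∨ r ∈ links G A v B := by
  by_cases hrv : r ∈ closedNbrs G A v
  · right
    rcases mem_closedNbrs.1 hrv with rfl | hrv
    · have := hB.1 hb
      simp only [mem_sdiff, mem_closedNbrs, not_or] at this
      exact (this.2.2 ⟨this.1, h.symm⟩).elim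
    · exact mem_links.2 ⟨hrv, b, hb, h.symm⟩
  · exact Or.inl (hB.2 b hb r (mem_sdiff.2 ⟨hr, hrv⟩) h)

/-- With at most one link, a single vertex would cut off `B`. -/
theorem Critical.two_le_card_links {A B : Finset V} (hA : Critical G A) {v : V} (hv : v ∈ A)
    (hB : ExcComp G (A \ closedNbrs G A v) B) : 2 ≤ #(links G A v B) := by
  by_contra! hcon
  have : ∃ x ∈ closedNbrs G A v, links G A v B ⊆ {x} := by
    rcases (links G A v B).eq_empty_or_nonempty with h | ⟨x, hx⟩
    · exact ⟨v, by simp, by simp [h]⟩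
    · refine ⟨x, mem_closedNbrs.2 (Or.inr (mem_links.1 hx).1), fun y hy => ?_⟩
      exact mem_singleton.2 (card_le_one.1 (by omega) y hy x hx)
  obtain ⟨x, hx, hsub⟩ := this
  refine hA.not_excComp_erase (closedNbrs_subset hv hx) B
    ⟨hB.exc, hB.conn, fun b hb => ?_, fun b hb r hr h => ?_⟩
  · have := hB.closed.1 hb
    rw [mem_sdiff] at this ⊢
    refine ⟨this.1, fun h => this.2 ?_⟩
    rwa [mem_singleton.1 h]
  · rw [mem_sdiff] at hr
    exact (hB.closed.mem_or_mem_links hb hr.1 h).resolve_right fun h' => hr.2 (hsub h')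

/-- The set of exceptional components of `A - N[v]`. -/
noncomputable def excComps (G : SimpleGraph V) (A : Finset V) (v : V) : Finset (Finset V) :=
  A.powerset.filter (ExcComp G (A \ closedNbrs G A v))

theorem mem_excComps {A B : Finset V} {v : V} :
    B ∈ excComps G A v ↔ ExcComp G (A \ closedNbrs G A v) B := by
  simp only [excComps, mem_filter, mem_powerset, and_iff_right_iff_imp]
  exact fun h => h.closed.1.trans sdiff_subset

/-- Delete `N[v]` at the price of `v` and one link per exceptional component. The image of `f` is
counted rather than the components, so that a shared link is paid for once. -/
theorem Critical.card_nbrs_lt {A : Finset V} (hA : Critical G A) {v : V} (hv : v ∈ A)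
    (f : Finset V → V) (hf : ∀ B ∈ excComps G A v, f B ∈ links G A v B) :
    #(nbrs G A v) + 4 * #(excComps G A v) < 4 + 5 * #((excComps G A v).image f) := by
  by_contra! hcon
  refine hA.false_of_linked (T := insert v ((excComps G A v).image f)) (closedNbrs_subset hv) ?_
    (by simp) ?_ ?_ (excComps G A v) (fun B hB => mem_excComps.1 hB) ?_
  · refine insert_subset (by simp) fun x hx => ?_
    obtain ⟨B, hB, rfl⟩ := mem_image.1 hx
    exact mem_closedNbrs.2 (Or.inr (mem_links.1 (hf B hB)).1)
  · intro Q _ _ hq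
    rw [disjoint_left]
    intro x hx hxv
    refine hq x hx ?_
    rcases mem_closedNbrs.1 hxv with rfl | h
    · exact Or.inl (by simp)
    · exact Or.inr ⟨v, by simp, h.2⟩
  · intro B hB
    rw [← mem_excComps] at hB
    obtain ⟨b, hb, h⟩ := (mem_links.1 (hf B hB)).2
    exact ⟨f B, mem_insert_of_mem (mem_image_of_mem f hB), b, hb, h⟩
  · have := card_insert_le v ((excComps G A v).image f)
    rw [card_closedNbrs]
    omega

theorem Critical.exists_link_fun {A : Finset V} (hA : Critical G A) {v : V} (hv : v ∈ A) :
    ∃ f : Finset V → V, ∀ B ∈ excComps G A v, f B ∈ links G A v B := by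
  have : ∀ B, ∃ x, B ∈ excComps G A v → x ∈ links G A v B := by
    intro B
    by_cases hB : B ∈ excComps G A v
    · have := hA.two_le_card_links hv (mem_excComps.1 hB)
      obtain ⟨x, hx⟩ := card_pos.1 (by omega : 0 < #(links G A v B))
      exact ⟨x, fun _ => hx⟩
    · exact ⟨v, fun h => (hB h).elim⟩
  choose f hf using this
  exact ⟨f, hf⟩

/-- If `B` and `C` share a link `x`, let `f` choose `x` for both. Its image then has size at most `k
- 1`, and `Critical.card_nbrs_lt` makes `deg v` smaller than the size of a set of neighbours of `v`.
-/
theorem Critical.disjoint_links {A B C : Finset V} (hA : Critical G A) {v : V} (hv : v ∈ A)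
    (hB : ExcComp G (A \ closedNbrs G A v) B) (hC : ExcComp G (A \ closedNbrs G A v) C)
    (hne : B ≠ C) : Disjoint (links G A v B) (links G A v C) := by
  rw [← mem_excComps] at hB hC
  rw [disjoint_left]
  intro x hxB hxC
  obtain ⟨f, hf⟩ := hA.exists_link_fun hv
  have h := hA.card_nbrs_lt hv (fun D => if D = B ∨ D = C then x else f D) (by
    intro D hD
    split_ifs with h
    · rcases h with rfl | rfl <;> assumption
    · exact hf D hD)
  set g : Finset V → V := fun D => if D = B ∨ D = C then x else f D with hg
  have h1 : (excComps G A v).image g = ((excComps G A v).erase B).image g := by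
    refine subset_antisymm (fun y hy => ?_) (image_subset_image (erase_subset _ _))
    obtain ⟨D, hD, rfl⟩ := mem_image.1 hy
    by_cases hDB : D = B
    · exact mem_image.2 ⟨C, by simp [hC, hne.symm], by simp [hg, hDB]⟩
    · exact mem_image_of_mem g (by simp [hD, hDB])
  have h2 : #((excComps G A v).image g) ≤ #(excComps G A v) - 1 := by
    rw [h1, ← card_erase_of_mem hB]
    exact card_image_le
  have h3 : #((excComps G A v).image g) ≤ #(nbrs G A v) := by
    refine card_le_card fun y hy => ?_
    obtain ⟨D, hD, rfl⟩ := mem_image.1 hy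
    refine links_subset (B := D) ?_
    simp only [hg]
    split_ifs with h
    · rcases h with rfl | rfl <;> assumption
    · exact hf D hD
  have h4 : 0 < #(excComps G A v) := card_pos.2 ⟨B, hB⟩
  omega

theorem Critical.card_nbrs_le {A : Finset V} (hA : Critical G A) {v : V} (hv : v ∈ A) :
    #(nbrs G A v) ≤ 3 + #(excComps G A v) := by
  obtain ⟨f, hf⟩ := hA.exists_link_fun hv
  have := hA.card_nbrs_lt hv f hf
  have : #((excComps G A v).image f) ≤ _ := card_image_le
  omega

theorem Critical.sum_card_links_le {A : Finset V} (hA : Critical G A) {v : V} (hv : v ∈ A) :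
    ∑ B ∈ excComps G A v, #(links G A v B) ≤ #(nbrs G A v) := by
  rw [← card_biUnion]
  · exact card_le_card (biUnion_subset.2 fun B _ => links_subset)
  · intro B hB C hC hne
    exact hA.disjoint_links hv (mem_excComps.1 hB) (mem_excComps.1 hC) hne

/-- There are at most `3 + k` links in all, and each of the other `k - 2` components uses at least
two. This leaves `7 - k ≤ 5`. -/
theorem Critical.card_links_add_card_links_le {A B C : Finset V} (hA : Critical G A) {v : V}
    (hv : v ∈ A) (hB : ExcComp G (A \ closedNbrs G A v) B)
    (hC : ExcComp G (A \ closedNbrs G A v) C) (hne : B ≠ C) :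
    #(links G A v B) + #(links G A v C) ≤ 5 := by
  have h1 := hA.card_nbrs_le hv
  have h2 := hA.sum_card_links_le hv
  have hsub : ({B, C} : Finset (Finset V)) ⊆ excComps G A v := by
    simp [insert_subset_iff, mem_excComps, hB, hC]
  have h3 := card_sdiff_add_card_eq_card hsub
  rw [← sum_sdiff hsub, sum_pair hne] at h2
  rw [card_pair hne] at h3
  have h4 : #(excComps G A v \ {B, C}) * 2 ≤ ∑ D ∈ excComps G A v \ {B, C}, #(links G A v D) := by
    rw [← smul_eq_mul]
    refine card_nsmul_le_sum _ _ _ fun D hD => ?_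
    exact hA.two_le_card_links hv (mem_excComps.1 (mem_sdiff.1 hD).1)
  omega

/-! ### At most one exceptional component in `A - N[v]`, and degree at most four -/

/-- If deleting an exceptional component `B` of `A - N[v]` together with some of its links can be
paid for, an exceptional component containing `v` must arise. -/
theorem Critical.exists_excComp_mem {A B K T : Finset V} (hA : Critical G A) {v : V} (hv : v ∈ A)
    (hB : ExcComp G (A \ closedNbrs G A v) B) (hBK : B ⊆ K) (hK : K ⊆ B ∪ links G A v B)
    (hTK : T ⊆ K) (hT : T.Nonempty)
    (hdia : ∀ Q ⊆ A, IsDiamondSet G Q → (∀ q ∈ Q, ¬ Covers G T q) → Disjoint Q K)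
    (hcard : 5 * #T ≤ #K) : ∃ E, ExcComp G (A \ K) E ∧ v ∈ E := by
  have hKA : K ⊆ A := hK.trans (union_subset (hB.closed.1.trans sdiff_subset)
    (links_subset.trans (filter_subset _ _)))
  obtain ⟨E, hE⟩ := hA.exists_excComp hKA hTK hT hdia hcard
  refine ⟨E, hE, ?_⟩
  by_contra hvE
  have hvK : v ∉ K := by
    intro h
    rcases mem_union.1 (hK h) with h | h
    · simpa using hB.closed.1 h
    · simp at h
  have hEv : ∀ e ∈ E, e ∈ A ∧ e ∉ K ∧ e ∉ closedNbrs G A v := by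
    intro e he
    have h := mem_sdiff.1 (hE.closed.1 he)
    refine ⟨h.1, h.2, fun h' => ?_⟩
    rcases mem_closedNbrs.1 h' with rfl | h'
    · exact hvE he
    · exact hvE (hE.closed.2 e he v (mem_sdiff.2 ⟨hv, hvK⟩) h'.2.symm)
  -- If `E` misses `v`, it avoids `N[v]` and is a second exceptional component there. Its links are
  -- disjoint from those of `B`, so they survive the deletion and force `E` to meet `N(v)`.
  have hEc : ExcComp G (A \ closedNbrs G A v) E := by
    refine ⟨hE.exc, hE.conn, fun e he => mem_sdiff.2 ⟨(hEv e he).1, (hEv e he).2.2⟩, ?_⟩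
    intro e he r hr h
    rw [mem_sdiff] at hr
    refine hE.closed.2 e he r (mem_sdiff.2 ⟨hr.1, fun hrK => ?_⟩) h
    rcases mem_union.1 (hK hrK) with hrB | hrB
    · refine (hEv e he).2.1 (hBK (hB.closed.2 r hrB e ?_ h.symm))
      exact mem_sdiff.2 ⟨(hEv e he).1, (hEv e he).2.2⟩
    · exact hr.2 (mem_closedNbrs.2 (Or.inr (mem_links.1 hrB).1))
  have hne : B ≠ E := by
    rintro rfl
    obtain ⟨b, hb⟩ := hB.conn.1
    exact (hEv b hb).2.1 (hBK hb)
  have hL := hA.two_le_card_links hv hEc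
  obtain ⟨y, hy⟩ := card_pos.1 (by omega : 0 < #(links G A v E))
  have hyK : y ∉ K := by
    intro h
    rcases mem_union.1 (hK h) with h | h
    · have := hB.closed.1 h
      simp only [mem_sdiff, mem_closedNbrs, not_or] at this
      exact this.2.2 (mem_links.1 hy).1
    · exact disjoint_left.1 (hA.disjoint_links hv hB hEc hne) h hy
  obtain ⟨hy1, e, he, h⟩ := mem_links.1 hy
  have := hE.closed.2 e he y (mem_sdiff.2 ⟨hy1.1, hyK⟩) h.symm
  exact (hEv y this).2.2 (mem_closedNbrs.2 (Or.inr hy1))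

/-- The version of `Critical.exists_excComp_mem` with a single deleted closed neighbourhood. -/
theorem Critical.exists_excComp_mem_of_singleton {A B : Finset V} (hA : Critical G A) {v : V}
    (hv : v ∈ A) (hB : ExcComp G (A \ closedNbrs G A v) B) {t : V} (ht : t ∈ B)
    (hext : ∃ x ∈ A, x ∉ B ∧ G.Adj t x)
    (hpend : ∀ u ∈ B, u ≠ t → ¬ G.Adj t u → ∀ p ∈ A, ∀ q ∈ A, ¬ G.Adj t p → ¬ G.Adj t q →
      G.Adj u p → G.Adj u q → p = q) :
    ∃ E, ExcComp G (A \ (B ∪ nbrs G A t)) E ∧ v ∈ E := by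
  refine hA.exists_excComp_mem (T := {t}) hv hB subset_union_left
    (union_subset subset_union_left fun r hr => ?_) (by simp [ht]) (by simp)
    (disjoint_of_pendant ?_) ?_
  · rw [mem_nbrs] at hr
    exact mem_union.2 (hB.closed.mem_or_mem_links ht hr.1 hr.2)
  · intro u hu huc p hp q hq hpc hqc
    rw [covers_singleton] at huc hpc hqc
    push Not at huc hpc hqc
    rcases mem_union.1 hu with hu | hu
    · exact hpend u hu huc.1 huc.2 p hp q hq hpc.2 hqc.2
    · exact (huc.2 (mem_nbrs.1 hu).2).elim
  · obtain ⟨x, hx, hxB, h⟩ := hext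
    have h1 : insert x B ⊆ B ∪ nbrs G A t :=
      insert_subset (by simp [hx, h]) subset_union_left
    have h2 := card_le_card h1
    rw [card_insert_of_notMem hxB] at h2
    have := hB.exc.four_le_card
    simp only [card_singleton]
    omega

/-- A diamond with at most three links contains a vertex whose closed neighbourhood may be
deleted. -/
theorem IsDiamondSet.exists_pendant {A B : Finset V} {v : V} (hBd : IsDiamondSet G B)
    (hB : ClosedIn G B (A \ closedNbrs G A v)) (h0 : (links G A v B).Nonempty)
    (h3 : #(links G A v B) ≤ 3) :
    ∃ t ∈ B, (∃ x ∈ A, x ∉ B ∧ G.Adj t x) ∧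
      ∀ u ∈ B, u ≠ t → ¬ G.Adj t u → ∀ p ∈ A, ∀ q ∈ A, ¬ G.Adj t p → ¬ G.Adj t q →
        G.Adj u p → G.Adj u q → p = q := by
  by_contra! hcon
  have hlink : ∀ x ∈ links G A v B, x ∈ A ∧ x ∉ B := by
    intro x hx
    refine ⟨(mem_links.1 hx).1.1, fun h => ?_⟩
    have := hB.1 h
    simp only [mem_sdiff, mem_closedNbrs, not_or] at this
    exact this.2.2 (mem_links.1 hx).1
  have hext : ∀ {t p}, t ∈ B → p ∈ A → p ∉ B → G.Adj t p → p ∈ links G A v B :=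
    fun ht hp hpB h => (hB.mem_or_mem_links ht hp h).resolve_left hpB
  obtain ⟨a, b, c, d, hab, hac, had, hbc, hbd, hcd, hBeq⟩ := hBd
  have haB : a ∈ B := by simp [hBeq]
  have hbB : b ∈ B := by simp [hBeq]
  have hcB : c ∈ B := by simp [hBeq]
  have hdB : d ∈ B := by simp [hBeq]
  have hmem : ∀ u ∈ B, u = a ∨ u = b ∨ u = c ∨ u = d := by simp [hBeq]
  -- If an end `t` with an outer neighbour is unsuitable, the opposite end `w` has two links not
  -- adjacent to `t`. Doing this at both ends produces four distinct links.
  have key : ∀ t ∈ B, ∀ w, G.Adj a t → G.Adj b t →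
      (∀ u ∈ B, u ≠ t → ¬ G.Adj t u → u = w) → (∃ x ∈ A, x ∉ B ∧ G.Adj t x) →
      ∃ p q, p ≠ q ∧ p ∈ links G A v B ∧ q ∈ links G A v B ∧ ¬ G.Adj t p ∧ ¬ G.Adj t q ∧
        G.Adj w p ∧ G.Adj w q := by
    intro t ht w hat hbt hw hx
    obtain ⟨u, hu, hut, htu, p, hp, q, hq, hp1, hq1, hp2, hq2, hpq⟩ := hcon t ht hx
    obtain rfl := hw u hu hut htu
    have hnB : ∀ z, ¬ G.Adj t z → G.Adj u z → z ∉ B := by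
      intro z h1 h2 hz
      by_cases hzt : z = t
      · exact htu (hzt ▸ h2.symm)
      · exact h2.ne (hw z hz hzt h1).symm
    exact ⟨p, q, hpq, hext hu hp (hnB p hp1 hp2) hp2, hext hu hq (hnB q hq1 hq2) hq2, hp1, hq1,
      hp2, hq2⟩
  -- A hub with an outer neighbour would already be suitable, since it is adjacent to all other
  -- vertices of `B`.
  have hA' : ∀ x ∈ A, x ∉ B → ¬ G.Adj a x := by
    intro x hx hxB h
    obtain ⟨u, hu, h1, h2, -⟩ := hcon a haB ⟨x, hx, hxB, h⟩
    rcases hmem u hu with rfl | rfl | rfl | rfl <;> contradiction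
  have hB' : ∀ x ∈ A, x ∉ B → ¬ G.Adj b x := by
    intro x hx hxB h
    obtain ⟨u, hu, h1, h2, -⟩ := hcon b hbB ⟨x, hx, hxB, h⟩
    rcases hmem u hu with rfl | rfl | rfl | rfl
    · exact h2 hab.symm
    all_goals contradiction
  have hkc := key c hcB d hac hbc (by
    intro u hu h1 h2
    rcases hmem u hu with rfl | rfl | rfl | rfl
    · exact (h2 hac.symm).elim
    · exact (h2 hbc.symm).elim
    · exact (h1 rfl).elim
    · rfl)
  have hkd := key d hdB c had hbd (by
    intro u hu h1 h2
    rcases hmem u hu with rfl | rfl | rfl | rfl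
    · exact (h2 had.symm).elim
    · exact (h2 hbd.symm).elim
    · rfl
    · exact (h1 rfl).elim)
  have hcx : ∃ x ∈ A, x ∉ B ∧ G.Adj c x := by
    obtain ⟨x, hx⟩ := h0
    obtain ⟨hxA, hxB⟩ := hlink x hx
    obtain ⟨-, y, hy, hxy⟩ := mem_links.1 hx
    rcases hmem y hy with rfl | rfl | rfl | rfl
    · exact (hA' x hxA hxB hxy.symm).elim
    · exact (hB' x hxA hxB hxy.symm).elim
    · exact ⟨x, hxA, hxB, hxy.symm⟩
    · obtain ⟨p, q, -, hp, -, -, -, h, -⟩ := hkd ⟨x, hxA, hxB, hxy.symm⟩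
      exact ⟨p, (hlink p hp).1, (hlink p hp).2, h⟩
  obtain ⟨p, q, hpq, hp, hq, hcp, hcq, hdp, hdq⟩ := hkc hcx
  obtain ⟨r, s, hrs, hr, hs, hdr, hds, hcr, hcs⟩ :=
    hkd ⟨p, (hlink p hp).1, (hlink p hp).2, hdp⟩
  have hsub : ({p, q, r, s} : Finset V) ⊆ links G A v B := by
    simp only [insert_subset_iff, singleton_subset_iff]
    exact ⟨hp, hq, hr, hs⟩
  have := card_le_card hsub
  have hpr : p ≠ r := by rintro rfl; contradiction
  have hps : p ≠ s := by rintro rfl; contradiction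
  have hqr : q ≠ r := by rintro rfl; contradiction
  have hqs : q ≠ s := by rintro rfl; contradiction
  rw [card_insert_of_notMem (by simp [*]), card_insert_of_notMem (by simp [*]),
    card_insert_of_notMem (by simp [*]), card_singleton] at this
  omega

theorem Critical.exists_excComp_mem_of_card_links_le {A B : Finset V} (hA : Critical G A) {v : V}
    (hv : v ∈ A) (hB : ExcComp G (A \ closedNbrs G A v) B) (h3 : #(links G A v B) ≤ 3) :
    ∃ K E, B ⊆ K ∧ K ⊆ B ∪ links G A v B ∧ ExcComp G (A \ K) E ∧ v ∈ E := by
  have h2 := hA.two_le_card_links hv hB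
  have h0 : (links G A v B).Nonempty := card_pos.1 (by omega)
  rcases hB.exc with hBd | hBY
  · obtain ⟨t, ht, h1, h2⟩ := hBd.exists_pendant hB.closed h0 h3
    obtain ⟨E, hE, hvE⟩ := hA.exists_excComp_mem_of_singleton hv hB ht h1 h2
    refine ⟨_, E, subset_union_left, union_subset subset_union_left fun r hr => ?_, hE, hvE⟩
    rw [mem_nbrs] at hr
    exact mem_union.2 (hB.closed.mem_or_mem_links ht hr.1 hr.2)
  · obtain ⟨x, hx⟩ := h0
    obtain ⟨hx1, b, hb, hxb⟩ := mem_links.1 hx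
    have hxB : x ∉ B := fun h => by
      have := hB.closed.1 h
      simp only [mem_sdiff, mem_closedNbrs, not_or] at this
      exact this.2.2 hx1
    obtain ⟨f, hf, hfB, rfl, hadj⟩ := hBY.exists_param hb
    have hfm : ∀ i, f i ∈ B := fun i => hfB ▸ mem_image_of_mem f (mem_univ i)
    -- The vertices `0` and `4` dominate `Y`; its nine vertices and the link `x` pay for both.
    refine ⟨B ∪ nbrs G A (f 0) ∪ nbrs G A (f 4), ?_⟩
    have hK : B ∪ nbrs G A (f 0) ∪ nbrs G A (f 4) ⊆ B ∪ links G A v B := by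
      refine union_subset (union_subset subset_union_left fun r hr => ?_) fun r hr => ?_ <;>
      · rw [mem_nbrs] at hr
        exact mem_union.2 (hB.closed.mem_or_mem_links (hfm _) hr.1 hr.2)
    have hBK : B ⊆ B ∪ nbrs G A (f 0) ∪ nbrs G A (f 4) :=
      subset_union_left.trans subset_union_left
    obtain ⟨E, hE⟩ := hA.exists_excComp_mem (T := {f 0, f 4}) hv hB hBK hK
      (by simp [insert_subset_iff, hfm]) (by simp) (by
        intro Q _ _ hq
        rw [disjoint_left]
        intro u hu huK
        refine hq u hu ?_
        rcases mem_union.1 huK with huK | huK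
        · rcases mem_union.1 huK with huK | huK
          · rw [← hfB] at huK
            obtain ⟨i, -, rfl⟩ := mem_image.1 huK
            have hi : i = 0 ∨ i = 4 ∨ (0 - i = 1 ∨ 0 - i = 2 ∨ i - 0 = 1 ∨ i - 0 = 2) ∨
                (4 - i = 1 ∨ 4 - i = 2 ∨ i - 4 = 1 ∨ i - 4 = 2) := by
              clear * -
              revert i; decide
            rcases hi with rfl | rfl | hi | hi
            · exact Or.inl (by simp)
            · exact Or.inl (by simp)
            · exact Or.inr ⟨f 0, by simp, (hadj _ _).2 hi⟩
            · exact Or.inr ⟨f 4, by simp, (hadj _ _).2 hi⟩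
          · exact Or.inr ⟨f 0, by simp, (mem_nbrs.1 huK).2⟩
        · exact Or.inr ⟨f 4, by simp, (mem_nbrs.1 huK).2⟩)
      (by
        have h1 : insert x B ⊆ B ∪ nbrs G A (f 0) ∪ nbrs G A (f 4) :=
          insert_subset (by simp [hx1.1, hxb.symm]) hBK
        have h2 := card_le_card h1
        rw [card_insert_of_notMem hxB, hBY.card] at h2
        have := card_le_two (a := f 0) (b := f 4)
        omega)
    exact ⟨E, hBK, hK, hE⟩

/-- Two components have at most five links together, so `B` has only two and can be deleted. The
resulting exceptional component `E` contains `v`, `C` and the links of `C`. That is too much for a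
diamond. In a copy of `Y`, `C` would be the four vertices not in `N[v]`, with four links, one too
many. -/
theorem Critical.excComp_unique_of_card_links_le {A B C : Finset V} (hA : Critical G A) {v : V}
    (hv : v ∈ A) (hB : ExcComp G (A \ closedNbrs G A v) B)
    (hC : ExcComp G (A \ closedNbrs G A v) C)
    (hle : #(links G A v B) ≤ #(links G A v C)) : B = C := by
  by_contra hne
  have h5 := hA.card_links_add_card_links_le hv hB hC hne
  have hB2 := hA.two_le_card_links hv hB
  have hC2 := hA.two_le_card_links hv hC
  obtain ⟨K, E, hBK, hK, hE, hvE⟩ :=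
    hA.exists_excComp_mem_of_card_links_le hv hB (by omega)
  have hdisj := hA.disjoint_links hv hB hC hne
  have hCN : ∀ c ∈ C, c ∈ A ∧ c ∉ closedNbrs G A v := fun c hc => mem_sdiff.1 (hC.closed.1 hc)
  have hBN : ∀ c ∈ B, c ∈ A ∧ c ∉ closedNbrs G A v := fun c hc => mem_sdiff.1 (hB.closed.1 hc)
  have hLE : links G A v C ⊆ E := by
    intro y hy
    have hy' := (mem_links.1 hy).1
    refine hE.closed.2 v hvE y (mem_sdiff.2 ⟨hy'.1, fun h => ?_⟩) hy'.2
    rcases mem_union.1 (hK h) with h | h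
    · exact (hBN y h).2 (mem_closedNbrs.2 (Or.inr hy'))
    · exact disjoint_left.1 hdisj h hy
  have hCK : ∀ c ∈ C, c ∈ A \ K := by
    intro c hc
    refine mem_sdiff.2 ⟨(hCN c hc).1, fun h => ?_⟩
    rcases mem_union.1 (hK h) with h | h
    · exact hne (ClosedIn.eq_of_inter hB.conn hC.conn hB.closed hC.closed h hc)
    · exact (hCN c hc).2 (mem_closedNbrs.2 (Or.inr (mem_links.1 h).1))
  have hCE : C ⊆ E := by
    have : C ∩ E = C := by
      refine hC.conn.2 _ ?_ ⟨inter_subset_left, fun c hc r hr h => ?_⟩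
      · obtain ⟨y, hy⟩ := card_pos.1 (by omega : 0 < #(links G A v C))
        obtain ⟨-, c, hc, hyc⟩ := mem_links.1 hy
        exact ⟨c, mem_inter.2 ⟨hc, hE.closed.2 y (hLE hy) c (hCK c hc) hyc⟩⟩
      · exact mem_inter.2 ⟨hr, hE.closed.2 c (mem_inter.1 hc).2 r (hCK r hr) h⟩
    rw [← this]
    exact inter_subset_right
  have hCc := hC.exc.four_le_card
  rcases hE.exc with hEd | hEY
  · have h1 : insert v (links G A v C) ⊆ E := insert_subset hvE hLE
    have h2 : Disjoint (insert v (links G A v C)) C := by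
      rw [disjoint_left]
      intro y hy hyC
      refine (hCN y hyC).2 (mem_closedNbrs.2 ?_)
      rcases mem_insert.1 hy with rfl | hy
      · exact Or.inl rfl
      · exact Or.inr (mem_links.1 hy).1
    have h3 := card_le_card (union_subset h1 hCE)
    rw [card_union_of_disjoint h2, hEd.card, card_insert_of_notMem (by simp)] at h3
    omega
  · obtain ⟨f, hf, hfE, rfl, hadj⟩ := hEY.exists_param hvE
    have hfA : ∀ i, f i ∈ A := fun i =>
      (mem_sdiff.1 (hE.closed.1 (hfE ▸ mem_image_of_mem f (mem_univ i)))).1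
    have hsub : C ⊆ ({3, 4, 5, 6} : Finset (ZMod 9)).image f := by
      intro c hc
      have h1 := hCE hc
      rw [← hfE] at h1
      obtain ⟨i, -, rfl⟩ := mem_image.1 h1
      have h2 := (hCN _ hc).2
      rw [mem_closedNbrs, not_or] at h2
      have h3 : ¬ (0 - i = 1 ∨ 0 - i = 2 ∨ i - 0 = 1 ∨ i - 0 = 2) :=
        fun h => h2.2 ⟨hfA i, (hadj _ _).2 h⟩
      have h4 : i ≠ 0 := fun h => h2.1 (by rw [h])
      refine mem_image_of_mem f ?_
      clear h1 h2 hc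
      revert i; decide
    have hCeq := eq_of_subset_of_card_le hsub (card_image_le.trans hCc)
    have hL : ({1, 2, 7, 8} : Finset (ZMod 9)).image f ⊆ links G A (f 0) C := by
      intro y hy
      obtain ⟨i, hi, rfl⟩ := mem_image.1 hy
      have hi' : (0 - i = 1 ∨ 0 - i = 2 ∨ i - 0 = 1 ∨ i - 0 = 2) ∧
          ∃ j ∈ ({3, 4, 5, 6} : Finset (ZMod 9)),
            (i - j = 1 ∨ i - j = 2 ∨ j - i = 1 ∨ j - i = 2) := by
        clear hy
        revert i; decide
      obtain ⟨h1, j, hj, h2⟩ := hi'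
      refine mem_links.2 ⟨⟨hfA i, (hadj _ _).2 h1⟩, f j, ?_, (hadj _ _).2 h2⟩
      rw [hCeq]
      exact mem_image_of_mem f hj
    have h4 := card_le_card hL
    rw [card_image_of_injective _ hf] at h4
    have h6 : #({1, 2, 7, 8} : Finset (ZMod 9)) = 4 := rfl
    omega

theorem Critical.excComp_unique {A B C : Finset V} (hA : Critical G A) {v : V}
    (hv : v ∈ A) (hB : ExcComp G (A \ closedNbrs G A v) B)
    (hC : ExcComp G (A \ closedNbrs G A v) C) : B = C := by
  rcases le_total #(links G A v B) #(links G A v C) with h | h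
  · exact hA.excComp_unique_of_card_links_le hv hB hC h
  · exact (hA.excComp_unique_of_card_links_le hv hC hB h).symm

theorem Critical.card_nbrs_le_four {A : Finset V} (hA : Critical G A) {v : V} (hv : v ∈ A) :
    #(nbrs G A v) ≤ 4 := by
  have h1 := hA.card_nbrs_le hv
  have h2 : #(excComps G A v) ≤ 1 := card_le_one.2 fun B hB C hC =>
    hA.excComp_unique hv (mem_excComps.1 hB) (mem_excComps.1 hC)
  omega

/-- A copy of `Y` is excluded because its vertex adjacent to a link would have degree 5. -/
theorem Critical.exists_excComp_of_card_nbrs {A : Finset V} (hA : Critical G A) {v : V}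
    (hv : v ∈ A) (h4 : #(nbrs G A v) = 4) :
    ∃ B, ExcComp G (A \ closedNbrs G A v) B ∧ IsDiamondSet G B := by
  have h1 := hA.card_nbrs_le hv
  obtain ⟨B, hB⟩ := card_pos.1 (by omega : 0 < #(excComps G A v))
  rw [mem_excComps] at hB
  refine ⟨B, hB, hB.exc.resolve_right fun hY => ?_⟩
  have h2 := hA.two_le_card_links hv hB
  obtain ⟨x, hx⟩ := card_pos.1 (by omega : 0 < #(links G A v B))
  obtain ⟨hx1, b, hb, hxb⟩ := mem_links.1 hx
  have hBA : B ⊆ A := hB.closed.1.trans sdiff_subset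
  have hxB : x ∉ B := fun h => by
    have := hB.closed.1 h
    simp only [mem_sdiff, mem_closedNbrs, not_or] at this
    exact this.2.2 hx1
  have h5 : insert x (nbrs G B b) ⊆ nbrs G A b :=
    insert_subset (by simp [hx1.1, hxb.symm]) (nbrs_mono hBA b)
  have h6 := card_le_card h5
  rw [card_insert_of_notMem (by simp [hxB]), hY.card_nbrs hb] at h6
  have := hA.card_nbrs_le_four (hBA hb)
  omega

/-! ### How the diamond `H` left by a vertex of degree four is attached -/

/-- A diamond has at most one pair of non-adjacent vertices. -/
theorem IsDiamondSet.adj_of_not_adj {Q : Finset V} (h : IsDiamondSet G Q) {p q r s : V}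
    (hp : p ∈ Q) (hq : q ∈ Q) (hpq : p ≠ q) (hpq' : ¬ G.Adj p q) (hr : r ∈ Q) (hs : s ∈ Q)
    (hrs : r ≠ s) (hrp : r ≠ p) (hrq : r ≠ q) : G.Adj r s := by
  obtain ⟨a, b, c, d, hab, hac, had, hbc, hbd, hcd, rfl⟩ := h
  have key : ∀ x ∈ ({a, b, c, d} : Finset V), ∀ y ∈ ({a, b, c, d} : Finset V), x ≠ y →
      G.Adj x y ∨ (x = c ∧ y = d) ∨ (x = d ∧ y = c) := by
    intro x hx y hy hxy
    simp only [mem_insert, mem_singleton] at hx hy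
    rcases hx with rfl | rfl | rfl | rfl <;> rcases hy with rfl | rfl | rfl | rfl <;>
      simp_all [G.adj_comm]
  rcases key p hp q hq hpq with h | ⟨rfl, rfl⟩ | ⟨rfl, rfl⟩
  · contradiction
  all_goals
    rcases key r hr s hs hrs with h | ⟨rfl, rfl⟩ | ⟨rfl, rfl⟩
    · exact h
    all_goals contradiction

/-- Deleting `H ∪ N(t)` leaves an exceptional component `E` through `v`. As `t` takes two neighbours
of `v`, `E` is a diamond with `v` as an end and `m`, `n` as hubs. Deleting `N[v]`, `H` and the other
end `s` at the price of `t` and `m` then leaves a second exceptional component of `A - N[v]`. -/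
theorem Critical.false_of_two_outer {A H : Finset V} (hA : Critical G A) {v : V} (hv : v ∈ A)
    (hv4 : #(nbrs G A v) = 4) (hH : ExcComp G (A \ closedNbrs G A v) H) (hHd : IsDiamondSet G H)
    {t y z : V} (ht : t ∈ H) (hy : y ∈ A) (hz : z ∈ A) (hyH : y ∉ H) (hzH : z ∉ H) (hyz : y ≠ z)
    (hty : G.Adj t y) (htz : G.Adj t z)
    (hpend : ∀ u ∈ H, u ≠ t → ¬ G.Adj t u → ∀ p ∈ A, ∀ q ∈ A, ¬ G.Adj t p → ¬ G.Adj t q →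
      G.Adj u p → G.Adj u q → p = q) : False := by
  have hHN : ∀ h ∈ H, h ∈ A ∧ h ∉ closedNbrs G A v := fun h hh => mem_sdiff.1 (hH.closed.1 hh)
  obtain ⟨E, hE, hvE⟩ := hA.exists_excComp_mem_of_singleton hv hH ht ⟨y, hy, hyH, hty⟩ hpend
  have hlink : ∀ w ∈ A, w ∉ H → G.Adj t w → G.Adj v w := fun w hw hwH h =>
    ((mem_links.1 ((hH.closed.mem_or_mem_links ht hw h).resolve_left hwH)).1).2
  have hEv : ∀ e, e ∈ E → e ∈ A ∧ e ∉ H ∧ ¬ G.Adj t e := by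
    intro e he
    have := hE.closed.1 he
    simp only [mem_sdiff, mem_union, mem_nbrs] at this
    tauto
  have hyE : y ∉ E := fun h => (hEv y h).2.2 hty
  have hzE : z ∉ E := fun h => (hEv z h).2.2 htz
  have hnE : #(nbrs G E v) + 2 ≤ 4 := by
    have h1 : insert y (insert z (nbrs G E v)) ⊆ nbrs G A v := by
      refine insert_subset (by simp [hy, hlink y hy hyH hty])
        (insert_subset (by simp [hz, hlink z hz hzH htz]) (nbrs_mono (fun e he => (hEv e he).1) v))
    have h2 := card_le_card h1
    rw [card_insert_of_notMem (by simp [hyz, hyE]), card_insert_of_notMem (by simp [hzE])] at h2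
    omega
  have hEd : IsDiamondSet G E := by
    refine hE.exc.resolve_right fun h => ?_
    have := h.card_nbrs hvE
    omega
  have hno3 : ∀ p q r, p ∈ E → q ∈ E → r ∈ E → p ≠ q → p ≠ r → q ≠ r → G.Adj v p → G.Adj v q →
      ¬ G.Adj v r := by
    intro p q r hp hq hr h1 h2 h3 h4 h5 h6
    have := card_le_card (show ({p, q, r} : Finset V) ⊆ nbrs G E v by simp [insert_subset_iff, *])
    rw [card_insert_of_notMem (by simp [*]), card_insert_of_notMem (by simp [*]),
      card_singleton] at this
    omega
  have hex : ∃ m n s, G.Adj m n ∧ G.Adj m v ∧ G.Adj n v ∧ G.Adj m s ∧ G.Adj n s ∧ s ≠ v ∧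
      ¬ G.Adj v s ∧ E = {m, n, v, s} := by
    obtain ⟨m, n, r, s, hmn, hmr, hms, hnr, hns, hrs, rfl⟩ := id hEd
    simp only [mem_insert, mem_singleton] at hvE
    rcases hvE with rfl | rfl | rfl | rfl
    · exact (hno3 n r s (by simp) (by simp) (by simp) hnr.ne hns.ne hrs hmn hmr hms).elim
    · exact (hno3 m r s (by simp) (by simp) (by simp) hmr.ne hms.ne hrs hmn.symm hnr hns).elim
    · exact ⟨m, n, s, hmn, hmr, hnr, hms, hns, hrs.symm,
        hno3 m n s (by simp) (by simp) (by simp) hmn.ne hms.ne hns.ne hmr.symm hnr.symm, rfl⟩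
    · refine ⟨m, n, r, hmn, hms, hns, hmr, hnr, hrs,
        hno3 m n r (by simp) (by simp) (by simp) hmn.ne hmr.ne hnr.ne hms.symm hns.symm, ?_⟩
      rw [pair_comm r v]
  obtain ⟨m, n, s, hmn, hmv, hnv, hms, hns, hsv, hvs, hEeq⟩ := hex
  have hmE : m ∈ E := by simp [hEeq]
  have hnE' : n ∈ E := by simp [hEeq]
  have hsE : s ∈ E := by simp [hEeq]
  have hdisj : Disjoint H (closedNbrs G A v) := disjoint_left.2 fun h hh => (hHN h hh).2
  -- Exactly ten vertices are deleted, `1 + 4 + 5`, which pays for two. The vertex `s` is needed for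
  -- the tenth.
  obtain ⟨P, hP⟩ := hA.exists_excComp (T := {t, m}) (K := insert s (H ∪ closedNbrs G A v))
    (insert_subset (hEv s hsE).1 (union_subset (fun h hh => (hHN h hh).1) (closedNbrs_subset hv)))
    (by
      have := (hEv m hmE).1
      simp [insert_subset_iff, ht, hmv.symm, this])
    (by simp)
    (disjoint_of_pendant (by
      intro u hu huc p hp q hq hpc hqc hup huq
      have hc : ∀ w, ¬ Covers G {t, m} w → w ≠ t ∧ w ≠ m ∧ ¬ G.Adj t w ∧ ¬ G.Adj m w := by
        intro w hw
        simp only [Covers, mem_insert, mem_singleton, exists_eq_or_imp, exists_eq_left] at hw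
        tauto
      obtain ⟨h1, h2, h3, h4⟩ := hc u huc
      have huH : u ∈ H := by
        rcases mem_insert.1 hu with rfl | hu
        · contradiction
        · rcases mem_union.1 hu with hu | hu
          · exact hu
          · exfalso
            rcases mem_closedNbrs.1 hu with rfl | hu
            · contradiction
            · have huE : u ∈ E := by
                refine hE.closed.2 v hvE u ?_ hu.2
                simp only [mem_sdiff, mem_union, mem_nbrs, not_or, not_and]
                refine ⟨hu.1, fun h => (hHN u h).2 (by simp [hu]), fun _ => h3⟩
              rw [hEeq] at huE
              simp only [mem_insert, mem_singleton] at huE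
              rcases huE with rfl | rfl | rfl | rfl <;> contradiction
      exact hpend u huH h1 h3 p hp q hq (hc p hpc).2.2.1 (hc q hqc).2.2.1 hup huq))
    (by
      have h1 := card_le_two (a := t) (b := m)
      have h2 : #(insert s (H ∪ closedNbrs G A v)) = 10 := by
        rw [card_insert_of_notMem (by simp [(hEv s hsE).2.1, hsv, hvs]),
          card_union_of_disjoint hdisj, card_closedNbrs, hv4, hHd.card]
      omega)
  have hPN : ∀ p, p ∈ P → p ∈ A ∧ p ≠ s ∧ p ∉ H ∧ p ∉ closedNbrs G A v := by
    intro p hp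
    have := hP.closed.1 hp
    simp only [mem_sdiff, mem_insert, mem_union, not_or] at this
    exact ⟨this.1, this.2.1, this.2.2.1, this.2.2.2⟩
  have hPc : ExcComp G (A \ closedNbrs G A v) P := by
    refine ⟨hP.exc, hP.conn, fun p hp => mem_sdiff.2 ⟨(hPN p hp).1, (hPN p hp).2.2.2⟩, ?_⟩
    intro p hp r hr hpr
    obtain ⟨h1, h2, h3, h4⟩ := hPN p hp
    obtain ⟨hrA, hrN⟩ := mem_sdiff.1 hr
    refine hP.closed.2 p hp r ?_ hpr
    simp only [mem_sdiff, mem_insert, mem_union, not_or]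
    refine ⟨hrA, ?_, fun hrH => ?_, hrN⟩
    · rintro rfl
      have hpE : p ∈ E := by
        refine hE.closed.2 r hsE p ?_ hpr.symm
        simp only [mem_sdiff, mem_union, mem_nbrs, not_or, not_and]
        exact ⟨h1, h3, fun _ h => h4 (by simp [h1, hlink p h1 h3 h])⟩
      rw [hEeq] at hpE
      simp only [mem_insert, mem_singleton] at hpE
      rw [mem_closedNbrs, not_or, not_and] at h4
      rcases hpE with rfl | rfl | rfl | rfl
      · exact h4.2 h1 hmv.symm
      · exact h4.2 h1 hnv.symm
      · exact h4.1 rfl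
      · exact h2 rfl
    · exact h3 (hH.closed.2 r hrH p (mem_sdiff.2 ⟨h1, h4⟩) hpr.symm)
  have := hA.excComp_unique hv hH hPc
  subst this
  exact (hPN t ht).2.2.1 ht

/-- Deleting `H ∪ N(t)` removes only `x` from `N[v]`. The exceptional component through `v` has `v`
and its three other neighbours, so it is exactly this diamond and has no further edges out. -/
theorem Critical.mem_of_adj_of_one_outer {A H : Finset V} (hA : Critical G A) {v : V} (hv : v ∈ A)
    (hv4 : #(nbrs G A v) = 4) (hH : ExcComp G (A \ closedNbrs G A v) H)
    {t x : V} (ht : t ∈ H) (hx : x ∈ A) (hxH : x ∉ H)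
    (htx : G.Adj t x) (hone : ∀ y ∈ A, y ∉ H → G.Adj t y → y = x)
    (hpend : ∀ u ∈ H, u ≠ t → ¬ G.Adj t u → ∀ p ∈ A, ∀ q ∈ A, ¬ G.Adj t p → ¬ G.Adj t q →
      G.Adj u p → G.Adj u q → p = q) {y w : V} (hy : y ∈ nbrs G A v) (hyx : y ≠ x) (hw : w ∈ A)
    (hyw : G.Adj y w) : w ∈ closedNbrs G A v ∪ H := by
  have hHN : ∀ h ∈ H, h ∈ A ∧ h ∉ closedNbrs G A v := fun h hh => mem_sdiff.1 (hH.closed.1 hh)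
  obtain ⟨E, hE, hvE⟩ := hA.exists_excComp_mem_of_singleton hv hH ht ⟨x, hx, hxH, htx⟩ hpend
  have hxN : x ∈ nbrs G A v :=
    links_subset ((hH.closed.mem_or_mem_links ht hx htx).resolve_left hxH)
  have hNE : (nbrs G A v).erase x ⊆ E := by
    intro z hz
    obtain ⟨hzx, hz⟩ := mem_erase.1 hz
    rw [mem_nbrs] at hz
    have hzH : z ∉ H := fun h => (hHN z h).2 (by simp [hz])
    refine hE.closed.2 v hvE z ?_ hz.2
    simp only [mem_sdiff, mem_union, mem_nbrs, not_or, not_and]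
    exact ⟨hz.1, hzH, fun _ h => hzx (hone z hz.1 hzH h)⟩
  have hxE : x ∉ E := fun h => by
    have := hE.closed.1 h
    simp [hx, htx] at this
  have hEd : IsDiamondSet G E := by
    refine hE.exc.resolve_right fun h => ?_
    have h1 : insert x (nbrs G E v) ⊆ nbrs G A v :=
      insert_subset hxN (nbrs_mono (hE.closed.1.trans sdiff_subset) v)
    have h2 := card_le_card h1
    rw [card_insert_of_notMem (by simp [hxE]), h.card_nbrs hvE] at h2
    omega
  have hEeq : insert v ((nbrs G A v).erase x) = E := by
    refine eq_of_subset_of_card_le (insert_subset hvE hNE) ?_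
    rw [card_insert_of_notMem (by simp), card_erase_of_mem hxN, hEd.card, hv4]
  by_contra hcon
  simp only [mem_union, not_or] at hcon
  have hwE : w ∈ E := by
    refine hE.closed.2 y (hNE (mem_erase.2 ⟨hyx, hy⟩)) w ?_ hyw
    simp only [mem_sdiff, mem_union, mem_nbrs, not_or, not_and]
    refine ⟨hw, hcon.2, fun _ h => hcon.1 ?_⟩
    rw [hone w hw hcon.2 h]
    exact mem_closedNbrs.2 (Or.inr (mem_nbrs.1 hxN))
  rw [← hEeq] at hwE
  refine hcon.1 ?_
  rcases mem_insert.1 hwE with rfl | h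
  · simp
  · exact mem_closedNbrs.2 (Or.inr (mem_nbrs.1 (mem_erase.1 h).2))

/-- If all neighbours of `v` have their neighbours in `N[v] ∪ H`, then this is everything. -/
theorem Critical.eq_closedNbrs_union {A H : Finset V} (hA : Critical G A) {v : V} (hv : v ∈ A)
    (hH : ExcComp G (A \ closedNbrs G A v) H)
    (hN : ∀ y ∈ nbrs G A v, ∀ w ∈ A, G.Adj y w → w ∈ closedNbrs G A v ∪ H) :
    A = closedNbrs G A v ∪ H := by
  refine (hA.conn.2 _ ⟨v, by simp⟩ ⟨union_subset (closedNbrs_subset hv)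
    (hH.closed.1.trans sdiff_subset), fun b hb r hr h => ?_⟩).symm
  rcases mem_union.1 hb with hb | hb
  · rcases mem_closedNbrs.1 hb with rfl | hb
    · exact mem_union_left _ (mem_closedNbrs.2 (Or.inr ⟨hr, h⟩))
    · exact hN b (mem_nbrs.2 hb) r hr h
  · rcases hH.closed.mem_or_mem_links hb hr h with h | h
    · exact mem_union_right _ h
    · exact mem_union_left _ (mem_closedNbrs.2 (Or.inr (mem_links.1 h).1))

/-- Otherwise two different links, used in turn as the removed vertex, show that `A = N[v] ∪ H`.
Then one vertex suffices: a neighbour of `v` with the most neighbours in `H`. -/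
theorem Critical.exists_two_outer {A H : Finset V} (hA : Critical G A) {v : V} (hv : v ∈ A)
    (hv4 : #(nbrs G A v) = 4) (hH : ExcComp G (A \ closedNbrs G A v) H) (hHd : IsDiamondSet G H) :
    ∃ t ∈ H, ∃ y ∈ A, ∃ z ∈ A, y ∉ H ∧ z ∉ H ∧ y ≠ z ∧ G.Adj t y ∧ G.Adj t z := by
  by_contra! hcon
  have hone : ∀ t ∈ H, ∀ y ∈ A, ∀ z ∈ A, y ∉ H → z ∉ H → G.Adj t y → G.Adj t z → y = z := by
    intro t ht y hy z hz hyH hzH hty htz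
    by_contra hyz
    exact hcon t ht y hy z hz hyH hzH hyz hty htz
  have hHN : ∀ h ∈ H, h ∈ A ∧ h ∉ closedNbrs G A v := fun h hh => mem_sdiff.1 (hH.closed.1 hh)
  have hpend : ∀ t ∈ H, ∀ u ∈ H, u ≠ t → ¬ G.Adj t u → ∀ p ∈ A, ∀ q ∈ A, ¬ G.Adj t p →
      ¬ G.Adj t q → G.Adj u p → G.Adj u q → p = q := by
    intro t ht u hu hut htu p hp q hq htp htq hup huq
    have hnot : ∀ p, ¬ G.Adj t p → G.Adj u p → p ∉ H := by
      intro p htp hup hpH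
      have hpt : p ≠ t := by
        rintro rfl
        exact htu hup.symm
      exact htp (hHd.adj_of_not_adj ht hu hut.symm htu hpH ht hpt hpt hup.ne').symm
    exact hone u hu p hp q hq (hnot p htp hup) (hnot q htq huq) hup huq
  have hNH : ∀ y ∈ nbrs G A v, y ∈ A ∧ y ∉ H := by
    intro y hy
    rw [mem_nbrs] at hy
    exact ⟨hy.1, fun h => (hHN y h).2 (by simp [hy])⟩
  have hL := hA.two_le_card_links hv hH
  obtain ⟨x₁, hx₁, x₂, hx₂, hx12⟩ := one_lt_card.1 hL
  have hcl : ∀ x ∈ links G A v H, ∀ y ∈ nbrs G A v, y ≠ x → ∀ w ∈ A, G.Adj y w →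
      w ∈ closedNbrs G A v ∪ H := by
    intro x hx y hy hyx w hw hyw
    obtain ⟨-, t, ht, hxt⟩ := mem_links.1 hx
    obtain ⟨hxA, hxH⟩ := hNH x (links_subset hx)
    exact hA.mem_of_adj_of_one_outer hv hv4 hH ht hxA hxH hxt.symm
      (fun y hy hyH hty => hone t ht y hy x hxA hyH hxH hty hxt.symm) (hpend t ht) hy hyx hw hyw
  have hAeq := hA.eq_closedNbrs_union hv hH (fun y hy w hw hyw => by
    by_cases hyx : y = x₁
    · exact hcl x₂ hx₂ y hy (hyx ▸ hx12) w hw hyw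
    · exact hcl x₁ hx₁ y hy hyx w hw hyw)
  obtain ⟨x, hx, hmax⟩ := exists_max_image (nbrs G A v) (fun x => #(nbrs G H x))
    ⟨x₁, links_subset hx₁⟩
  have hvx := (mem_nbrs.1 hx).2
  have hpos : 1 ≤ #(nbrs G H x) := by
    refine le_trans ?_ (hmax x₁ (links_subset hx₁))
    obtain ⟨-, t, ht, hxt⟩ := mem_links.1 hx₁
    exact card_pos.2 ⟨t, by simp [ht, hxt]⟩
  refine hA.not_good ⟨{x}, by simpa using (hNH x hx).1, ?_, fun Q hQ hQd => ?_⟩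
  · have := card_le_card (closedNbrs_subset (G := G) hv)
    rw [card_closedNbrs, hv4] at this
    simpa using this
  by_contra! hcov
  have hcard : #(H \ nbrs G H x) + #(nbrs G H x) = 4 := by
    rw [card_sdiff_add_card_eq_card (show nbrs G H x ⊆ H from filter_subset _ _), hHd.card]
  have hloc : ∀ q ∈ Q, (q ∈ nbrs G A v ∧ q ≠ x) ∨ (q ∈ H \ nbrs G H x) := by
    intro q hq
    have h1 := hcov q hq
    rw [covers_singleton, not_or] at h1
    have h2 := hQ hq
    rw [hAeq] at h2
    rcases mem_union.1 h2 with h2 | h2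
    · rcases mem_closedNbrs.1 h2 with rfl | h2
      · exact (h1.2 hvx.symm).elim
      · exact Or.inl ⟨mem_nbrs.2 h2, h1.1⟩
    · exact Or.inr (by simp [h2, h1.2])
  -- Three vertices of `H` missed by `x` mean that `x` has at most one neighbour in `H`; by
  -- maximality so does `y`.
  have htri : ∀ p q r y, p ∈ H \ nbrs G H x → q ∈ H \ nbrs G H x → r ∈ H \ nbrs G H x → p ≠ q →
      p ≠ r → q ≠ r → y ∈ nbrs G A v → G.Adj y p → G.Adj y q → False := by
    intro p q r y hp hq hr hpq hpr hqr hy hyp hyq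
    have h1 := card_le_card (show ({p, q, r} : Finset V) ⊆ H \ nbrs G H x by
      simp only [insert_subset_iff, singleton_subset_iff]; exact ⟨hp, hq, hr⟩)
    rw [card_insert_of_notMem (by simp [hpq, hpr]), card_pair hqr] at h1
    have h2 := card_le_card (show ({p, q} : Finset V) ⊆ nbrs G H y by
      simp [insert_subset_iff, (mem_sdiff.1 hp).1, (mem_sdiff.1 hq).1, hyp, hyq])
    rw [card_pair hpq] at h2
    have h3 := hmax y hy
    omega
  have hone' : ∀ t y z, t ∈ H \ nbrs G H x → y ∈ nbrs G A v ∧ y ≠ x → z ∈ nbrs G A v ∧ z ≠ x →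
      G.Adj t y → G.Adj t z → y ≠ z → False := fun t y z ht hy hz hty htz hyz =>
    hyz (hone t (mem_sdiff.1 ht).1 y (hNH y hy.1).1 z (hNH z hz.1).1 (hNH y hy.1).2 (hNH z hz.1).2
      hty htz)
  obtain ⟨m, n, r, s, hmn, hmr, hms, hnr, hns, hrs, rfl⟩ := id hQd
  have hm := hloc m (by simp)
  have hn := hloc n (by simp)
  have hr := hloc r (by simp)
  have hs := hloc s (by simp)
  rcases hm with hm | hm <;> rcases hn with hn | hn
  · rcases hr with hr | hr
    · rcases hs with hs | hs
      · have hsub : ({m, n, r, s} : Finset V) ⊆ (nbrs G A v).erase x := by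
          simp only [insert_subset_iff, singleton_subset_iff, mem_erase]
          exact ⟨hm.symm, hn.symm, hr.symm, hs.symm⟩
        have := card_le_card hsub
        rw [hQd.card, card_erase_of_mem hx, hv4] at this
        omega
      · exact hone' s m n hs hm hn hms.symm hns.symm hmn.ne
    · exact hone' r m n hr hm hn hmr.symm hnr.symm hmn.ne
  · rcases hr with hr | hr
    · exact hone' n m r hn hm hr hmn.symm hnr hmr.ne
    · rcases hs with hs | hs
      · exact hone' n m s hn hm hs hmn.symm hns hms.ne
      · exact htri n r s m hn hr hs hnr.ne hns.ne hrs hm.1 hmn hmr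
  · rcases hr with hr | hr
    · exact hone' m n r hm hn hr hmn hmr hnr.ne
    · rcases hs with hs | hs
      · exact hone' m n s hm hn hs hmn hms hns.ne
      · exact htri m r s n hm hr hs hmr.ne hms.ne hrs hn.1 hmn.symm hnr
  · rcases hr with hr | hr
    · rcases hs with hs | hs
      · exact hone' m r s hm hr hs hmr hms hrs
      · exact htri m n s r hm hn hs hmn.ne hms.ne hns.ne hr.1 hmr.symm hnr.symm
    · rcases hs with hs | hs
      · exact htri m n r s hm hn hr hmn.ne hmr.ne hnr.ne hs.1 hms.symm hns.symm
      · have hsub : ({m, n, r, s} : Finset V) ⊆ H \ nbrs G H x := by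
          simp only [insert_subset_iff, singleton_subset_iff]
          exact ⟨hm, hn, hr, hs⟩
        have := card_le_card hsub
        rw [hQd.card] at this
        omega

/-- Here `c` has degree 4 too, so `A - N[c]` has a diamond component `P`. If `P` missed `v`, it
would be a second exceptional component of `A - N[v]`. Hence `P` is `{v, x₃, x₄, d}`, whose
non-adjacent pair is `v`, `d`. -/
theorem Critical.adj_and_closed_of_two_outer {A H : Finset V} (hA : Critical G A) {v : V}
    (hv : v ∈ A) (hH : ExcComp G (A \ closedNbrs G A v) H) {a b c d x₁ x₂ x₃ x₄ : V}
    (hHeq : H = {a, b, c, d}) (hab : a ≠ b) (hac : G.Adj a c) (hbc : G.Adj b c) (hcd : c ≠ d)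
    (hcd' : ¬ G.Adj c d) (h1 : x₁ ∈ nbrs G A v) (h2 : x₂ ∈ nbrs G A v) (h3 : x₃ ∈ nbrs G A v)
    (h4 : x₄ ∈ nbrs G A v) (h12 : x₁ ≠ x₂) (h34 : x₃ ≠ x₄) (hc1 : G.Adj c x₁) (hc2 : G.Adj c x₂)
    (hd3 : G.Adj d x₃) (hd4 : G.Adj d x₄) (hc3 : ¬ G.Adj c x₃) (hc4 : ¬ G.Adj c x₄) :
    G.Adj x₃ x₄ ∧ ∀ y, y = x₃ ∨ y = x₄ → ∀ w ∈ A, G.Adj y w → w ∈ closedNbrs G A v ∪ H := by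
  have hHN : ∀ h ∈ H, h ∈ A ∧ h ∉ closedNbrs G A v := fun h hh => mem_sdiff.1 (hH.closed.1 hh)
  have haH : a ∈ H := by simp [hHeq]
  have hbH : b ∈ H := by simp [hHeq]
  have hcH : c ∈ H := by simp [hHeq]
  have hdH : d ∈ H := by simp [hHeq]
  have hxH : ∀ x ∈ nbrs G A v, x ∈ A ∧ x ∉ H ∧ G.Adj v x := by
    intro x hx
    rw [mem_nbrs] at hx
    exact ⟨hx.1, fun h => (hHN x h).2 (by simp [hx]), hx.2⟩
  have hne : ∀ h ∈ H, ∀ x ∈ nbrs G A v, h ≠ x := by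
    rintro h hh x hx rfl
    exact (hxH h hx).2.1 hh
  have hcA := (hHN c hcH).1
  have hcv : ¬ G.Adj c v := fun h => (hHN c hcH).2 (by simp [hcA, h.symm])
  have hdv : ¬ G.Adj v d := fun h => (hHN d hdH).2 (by simp [(hHN d hdH).1, h])
  have hvH : v ∉ H := fun h => (hHN v h).2 (by simp)
  have nc := eq_of_adj_of_card_le_four (hA.card_nbrs_le_four hcA) ⟨(hHN a haH).1, hac.symm⟩
    ⟨(hHN b hbH).1, hbc.symm⟩ ⟨(hxH x₁ h1).1, hc1⟩ ⟨(hxH x₂ h2).1, hc2⟩ hab (hne a haH x₁ h1)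
    (hne a haH x₂ h2) (hne b hbH x₁ h1) (hne b hbH x₂ h2) h12
  have hc4' : #(nbrs G A c) = 4 := by
    refine le_antisymm (hA.card_nbrs_le_four hcA) ?_
    have := card_le_card (show ({a, b, x₁, x₂} : Finset V) ⊆ nbrs G A c by
      simp [insert_subset_iff, (hHN a haH).1, (hHN b hbH).1, (hxH x₁ h1).1, (hxH x₂ h2).1,
        hac.symm, hbc.symm, hc1, hc2])
    rwa [card_insert_of_notMem (by simp [hab, hne a haH x₁ h1, hne a haH x₂ h2]),
      card_insert_of_notMem (by simp [hne b hbH x₁ h1, hne b hbH x₂ h2]), card_pair h12] at this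
  obtain ⟨P, hP, hPd⟩ := hA.exists_excComp_of_card_nbrs hcA hc4'
  have hNc : ∀ w ∈ A, w ∈ closedNbrs G A c → w ∈ closedNbrs G A v ∪ H := by
    intro w hw hwc
    rcases mem_closedNbrs.1 hwc with rfl | ⟨-, hwc⟩
    · exact mem_union_right _ hcH
    · rcases nc w hw hwc with rfl | rfl | rfl | rfl
      · exact mem_union_right _ haH
      · exact mem_union_right _ hbH
      · exact mem_union_left _ (mem_closedNbrs.2 (Or.inr (mem_nbrs.1 h1)))
      · exact mem_union_left _ (mem_closedNbrs.2 (Or.inr (mem_nbrs.1 h2)))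
  have out : ∀ w ∈ A, w ≠ c → ¬ G.Adj c w → w ∈ A \ closedNbrs G A c := by
    intro w hw hwc hcw
    simp [hw, hwc, hcw]
  have hvout := out v hv (by rintro rfl; contradiction) hcv
  have hdout := out d (hHN d hdH).1 hcd.symm hcd'
  have h3out := out x₃ (hxH x₃ h3).1 (hne c hcH x₃ h3).symm hc3
  have h4out := out x₄ (hxH x₄ h4).1 (hne c hcH x₄ h4).symm hc4
  have hPN : ∀ p ∈ P, p ∈ A ∧ p ∉ closedNbrs G A c := fun p hp => mem_sdiff.1 (hP.closed.1 hp)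
  have hvP : v ∈ P := by
    by_contra hvP
    have hvadj : ∀ p ∈ P, ¬ G.Adj v p := fun p hp h => hvP (hP.closed.2 p hp v hvout h.symm)
    have hdP : d ∉ P := fun h =>
      hvadj x₃ (hP.closed.2 d h x₃ h3out hd3) (hxH x₃ h3).2.2
    have hPH : ∀ p ∈ P, p ∉ H := by
      intro p hp hpH
      rw [hHeq] at hpH
      simp only [mem_insert, mem_singleton] at hpH
      have h5 := (hPN p hp).2
      have h6 := (hPN p hp).1
      rw [mem_closedNbrs, not_or, not_and] at h5
      rcases hpH with rfl | rfl | rfl | rfl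
      · exact h5.2 h6 hac.symm
      · exact h5.2 h6 hbc.symm
      · exact h5.1 rfl
      · exact hdP hp
    have hPv : ∀ p ∈ P, p ∉ closedNbrs G A v := by
      intro p hp h
      rcases mem_closedNbrs.1 h with rfl | h
      · exact hvP hp
      · exact hvadj p hp h.2
    have hPc : ExcComp G (A \ closedNbrs G A v) P := by
      refine ⟨hP.exc, hP.conn, fun p hp => mem_sdiff.2 ⟨(hPN p hp).1, hPv p hp⟩, ?_⟩
      intro p hp r hr hpr
      obtain ⟨hrA, hrv⟩ := mem_sdiff.1 hr
      refine hP.closed.2 p hp r (mem_sdiff.2 ⟨hrA, fun hrc => ?_⟩) hpr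
      have hrH : r ∈ H := (mem_union.1 (hNc r hrA hrc)).resolve_left hrv
      exact hPH p hp (hH.closed.2 r hrH p (mem_sdiff.2 ⟨(hPN p hp).1, hPv p hp⟩) hpr.symm)
    have := hA.excComp_unique hv hH hPc
    exact hPH c (this ▸ hcH) hcH
  have h3P := hP.closed.2 v hvP x₃ h3out (hxH x₃ h3).2.2
  have h4P := hP.closed.2 v hvP x₄ h4out (hxH x₄ h4).2.2
  have hdP := hP.closed.2 x₃ h3P d hdout hd3.symm
  have hvd : v ≠ d := by rintro rfl; contradiction
  have hPeq : ({v, x₃, x₄, d} : Finset V) = P := by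
    refine eq_of_subset_of_card_le ?_ ?_
    · simp only [insert_subset_iff, singleton_subset_iff]
      exact ⟨hvP, h3P, h4P, hdP⟩
    · rw [hPd.card, card_insert_of_notMem (by
          simp [(hxH x₃ h3).2.2.ne, (hxH x₄ h4).2.2.ne, hvd]),
        card_insert_of_notMem (by simp [h34, hd3.ne']), card_pair hd4.ne']
  refine ⟨hPd.adj_of_not_adj hvP hdP hvd hdv h3P h4P h34 (hxH x₃ h3).2.2.ne' hd3.ne', ?_⟩
  intro y hy w hw hyw
  by_cases hwc : w ∈ closedNbrs G A c
  · exact hNc w hw hwc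
  · have hyP : y ∈ P := by rcases hy with rfl | rfl <;> assumption
    have hwP := hP.closed.2 y hyP w (mem_sdiff.2 ⟨hw, hwc⟩) hyw
    rw [← hPeq] at hwP
    simp only [mem_insert, mem_singleton] at hwP
    rcases hwP with rfl | rfl | rfl | rfl
    · simp
    · exact mem_union_left _ (mem_closedNbrs.2 (Or.inr (mem_nbrs.1 h3)))
    · exact mem_union_left _ (mem_closedNbrs.2 (Or.inr (mem_nbrs.1 h4)))
    · exact mem_union_right _ hdH

/-! ### Cyclic chains of three diamonds -/

/-- Adjacency in the cyclic chain of three diamonds on `{0, 1, 2, 3}`, `{3, 4, 5, 6}` and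
`{6, 7, 8, 0}`, that is, in `Y` without the edges `{8, 1}`, `{2, 4}` and `{5, 7}`. -/
def ChainAdj (i j : ZMod 9) : Prop :=
  (i - j = 1 ∨ i - j = 2 ∨ j - i = 1 ∨ j - i = 2) ∧
    (i, j) ∉ ({(8, 1), (1, 8), (2, 4), (4, 2), (5, 7), (7, 5)} : Finset (ZMod 9 × ZMod 9))

instance : DecidableRel ChainAdj := fun i j => by unfold ChainAdj; infer_instance

/-- `f` is a spanning cyclic chain of three diamonds in the subgraph induced by `A`. -/
structure IsDiamondChain (G : SimpleGraph V) (A : Finset V) (f : ZMod 9 → V) : Prop where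
  inj : Function.Injective f
  image_eq : univ.image f = A
  adj : ∀ i j, ChainAdj i j → G.Adj (f i) (f j)

theorem IsDiamondChain.comp {A : Finset V} {f : ZMod 9 → V} (h : IsDiamondChain G A f)
    (σ : Equiv.Perm (ZMod 9)) (hσ : ∀ i j, ChainAdj i j → ChainAdj (σ i) (σ j)) :
    IsDiamondChain G A (f ∘ σ) := by
  refine ⟨h.inj.comp σ.injective, ?_, fun i j hij => h.adj _ _ (hσ i j hij)⟩
  rw [← h.image_eq, ← image_image, image_univ_equiv]

theorem IsDiamondChain.mem {A : Finset V} {f : ZMod 9 → V} (h : IsDiamondChain G A f)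
    (i : ZMod 9) : f i ∈ A := h.image_eq ▸ mem_image_of_mem f (mem_univ i)

theorem IsDiamondChain.card_le {A : Finset V} {f : ZMod 9 → V} (h : IsDiamondChain G A f)
    (hA : Critical G A) {i : ZMod 9} {S : Finset (ZMod 9)} (hS : ∀ j ∈ S, G.Adj (f i) (f j)) :
    #S ≤ 4 := by
  rw [← card_image_of_injective S h.inj]
  refine (card_le_card fun y hy => ?_).trans (hA.card_nbrs_le_four (h.mem i))
  obtain ⟨j, hj, rfl⟩ := mem_image.1 hy
  exact mem_nbrs.2 ⟨h.mem j, hS j hj⟩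

/-- Adjacency in two triangles with the common vertex `3`. -/
def BowtieAdj (i j : ZMod 9) : Prop :=
  i ≠ j ∧ ¬ (i ∈ ({1, 2} : Finset (ZMod 9)) ∧ j ∈ ({4, 5} : Finset (ZMod 9))) ∧
    ¬ (j ∈ ({1, 2} : Finset (ZMod 9)) ∧ i ∈ ({4, 5} : Finset (ZMod 9)))

instance : DecidableRel BowtieAdj := fun i j => by unfold BowtieAdj; infer_instance

theorem not_diamond_of_bowtie : ∀ m ∈ ({1, 2, 3, 4, 5} : Finset (ZMod 9)),
    ∀ n ∈ ({1, 2, 3, 4, 5} : Finset (ZMod 9)), ∀ r ∈ ({1, 2, 3, 4, 5} : Finset (ZMod 9)),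
    ∀ s ∈ ({1, 2, 3, 4, 5} : Finset (ZMod 9)), ¬ (BowtieAdj m n ∧ BowtieAdj m r ∧
      BowtieAdj n r ∧ BowtieAdj m s ∧ BowtieAdj n s ∧ r ≠ s) := by
  decide

/-- The vertex `7` covers `6, 7, 8, 0`. Without the claimed edge, the rest lies in two triangles
sharing `3`, which contain no diamond. -/
theorem IsDiamondChain.exists_adj {A : Finset V} {f : ZMod 9 → V} (h : IsDiamondChain G A f)
    (hA : Critical G A) : ∃ i ∈ ({1, 2} : Finset (ZMod 9)), ∃ j ∈ ({4, 5} : Finset (ZMod 9)),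
      G.Adj (f i) (f j) := by
  by_contra! hcon
  refine hA.not_good ⟨{f 7}, by simpa using h.mem 7, ?_, fun Q hQ hQd => ?_⟩
  · rw [← h.image_eq, card_image_of_injective _ h.inj]
    simp [ZMod.card]
  by_contra! hcov
  have hloc : ∀ q ∈ Q, ∃ i ∈ ({1, 2, 3, 4, 5} : Finset (ZMod 9)), f i = q := by
    intro q hq
    have h1 := hcov q hq
    have h2 := hQ hq
    rw [← h.image_eq] at h2
    obtain ⟨i, -, rfl⟩ := mem_image.1 h2
    rw [covers_singleton, not_or] at h1
    have h3 : i ≠ 7 := fun h => h1.1 (by rw [h])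
    have h4 : ¬ ChainAdj 7 i := fun h' => h1.2 (h.adj _ _ h')
    refine ⟨i, ?_, rfl⟩
    clear h1 h2 hq
    revert i; decide
  obtain ⟨m', n', r', s', hmn, hmr, hms, hnr, hns, hrs, rfl⟩ := id hQd
  obtain ⟨m, hm, rfl⟩ := hloc m' (by simp)
  obtain ⟨n, hn, rfl⟩ := hloc n' (by simp)
  obtain ⟨r, hr, rfl⟩ := hloc r' (by simp)
  obtain ⟨s, hs, rfl⟩ := hloc s' (by simp)
  have hne : ∀ {i j}, f i ≠ f j → i ≠ j := fun h h' => h (by rw [h'])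
  have hadj : ∀ {i j}, G.Adj (f i) (f j) → BowtieAdj i j := fun h =>
    ⟨hne h.ne, fun ⟨hi, hj⟩ => hcon _ hi _ hj h, fun ⟨hj, hi⟩ => hcon _ hj _ hi h.symm⟩
  exact not_diamond_of_bowtie m hm n hn r hr s hs
    ⟨hadj hmn, hadj hmr, hadj hnr, hadj hms, hadj hns, hne hrs⟩

/-- A chain of three diamonds with the three further edges spans a copy of `Y`. -/
theorem IsDiamondChain.isCopyY {A : Finset V} {f : ZMod 9 → V} (h : IsDiamondChain G A f)
    (hA : Critical G A) (h24 : G.Adj (f 2) (f 4)) (h57 : G.Adj (f 5) (f 7))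
    (h81 : G.Adj (f 8) (f 1)) : IsCopyY G A := by
  refine ⟨f, h.inj, h.image_eq, fun i j => ?_⟩
  rw [graphY_adj]
  have hY : ∀ i j : ZMod 9, (i - j = 1 ∨ i - j = 2 ∨ j - i = 1 ∨ j - i = 2) →
      G.Adj (f i) (f j) := by
    intro i j hij
    by_cases hc : ChainAdj i j
    · exact h.adj i j hc
    · have : (i, j) ∈ ({(8, 1), (1, 8), (2, 4), (4, 2), (5, 7), (7, 5)} :
          Finset (ZMod 9 × ZMod 9)) := by
        by_contra h'
        exact hc ⟨hij, h'⟩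
      simp only [mem_insert, mem_singleton, Prod.mk.injEq] at this
      rcases this with ⟨rfl, rfl⟩ | ⟨rfl, rfl⟩ | ⟨rfl, rfl⟩ | ⟨rfl, rfl⟩ | ⟨rfl, rfl⟩ | ⟨rfl, rfl⟩
      exacts [h81, h81.symm, h24, h24.symm, h57, h57.symm]
  refine ⟨fun hij => ?_, hY i j⟩
  by_contra hcon
  have hcard : ∀ i : ZMod 9, 4 ≤ #(univ.filter fun j : ZMod 9 =>
      i - j = 1 ∨ i - j = 2 ∨ j - i = 1 ∨ j - i = 2) := by decide
  have h1 := h.card_le hA (i := i) (S := insert j (univ.filter fun j : ZMod 9 =>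
      i - j = 1 ∨ i - j = 2 ∨ j - i = 1 ∨ j - i = 2)) (by
    intro k hk
    rcases mem_insert.1 hk with rfl | hk
    · exact hij
    · exact hY i k (mem_filter.1 hk).2)
  rw [card_insert_of_notMem (by simpa using hcon)] at h1
  have := hcard i
  omega

/-- Rotations by 3 and swaps inside the middle pairs preserve the chain. An edge joins each two
consecutive middle pairs; swaps normalise the first two, and saturated vertices of degree 4
determine which endpoints remain possible. The three edges complete `Y`. -/
theorem IsDiamondChain.false {A : Finset V} {f : ZMod 9 → V} (h : IsDiamondChain G A f)
    (hA : Critical G A) : False := by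
  have s12 : ∀ i j, ChainAdj i j → ChainAdj (Equiv.swap 1 2 i) (Equiv.swap 1 2 j) := by decide
  have s45 : ∀ i j, ChainAdj i j → ChainAdj (Equiv.swap 4 5 i) (Equiv.swap 4 5 j) := by decide
  have s78 : ∀ i j, ChainAdj i j → ChainAdj (Equiv.swap 7 8 i) (Equiv.swap 7 8 j) := by decide
  have r3 : ∀ i j, ChainAdj i j → ChainAdj (Equiv.addRight 3 i) (Equiv.addRight 3 j) := by decide
  have r6 : ∀ i j, ChainAdj i j → ChainAdj (Equiv.addRight 6 i) (Equiv.addRight 6 j) := by decide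
  have step1 : ∃ f, IsDiamondChain G A f ∧ G.Adj (f 2) (f 4) := by
    obtain ⟨i, hi, j, hj, hij⟩ := h.exists_adj hA
    have hs : ∃ g, IsDiamondChain G A g ∧ G.Adj (g 2) (g j) := by
      simp only [mem_insert, mem_singleton] at hi
      rcases hi with rfl | rfl
      · refine ⟨_, h.comp _ s12, ?_⟩
        have : Equiv.swap (1 : ZMod 9) 2 j = j := by
          clear hij
          revert j; decide
        simpa [this] using hij
      · exact ⟨f, h, hij⟩
    obtain ⟨g, hg, hgj⟩ := hs
    simp only [mem_insert, mem_singleton] at hj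
    rcases hj with rfl | rfl
    · exact ⟨g, hg, hgj⟩
    · refine ⟨_, hg.comp _ s45, ?_⟩
      have : Equiv.swap (4 : ZMod 9) 5 2 = 2 := by decide
      simpa [this] using hgj
  obtain ⟨f, h, h24⟩ := step1
  have step2 : ∃ f, IsDiamondChain G A f ∧ G.Adj (f 2) (f 4) ∧ G.Adj (f 5) (f 7) := by
    obtain ⟨i, hi, j, hj, hij⟩ := (h.comp _ r3).exists_adj hA
    have hi' : Equiv.addRight (3 : ZMod 9) i = 5 := by
      simp only [mem_insert, mem_singleton] at hi
      rcases hi with rfl | rfl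
      · have h4 : Equiv.addRight (3 : ZMod 9) 1 = 4 := by decide
        have hj' : Equiv.addRight (3 : ZMod 9) j ∈ ({7, 8} : Finset (ZMod 9)) := by
          clear hij
          revert j; decide
        simp only [Function.comp_apply, h4] at hij
        generalize Equiv.addRight (3 : ZMod 9) j = k at hij hj'
        -- The vertex `4` already has the neighbours `2, 3, 5, 6`, so the new edge must start at
        -- `5`.
        have h5 := h.card_le hA (i := 4) (S := {3, 5, 6, 2, k}) (by
          intro l hl
          simp only [mem_insert, mem_singleton] at hl
          rcases hl with rfl | rfl | rfl | rfl | rfl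
          · exact h.adj _ _ (by decide)
          · exact h.adj _ _ (by decide)
          · exact h.adj _ _ (by decide)
          · exact h24.symm
          · exact hij)
        exfalso
        clear hij
        revert k; decide
      · decide
    simp only [Function.comp_apply, hi'] at hij
    simp only [mem_insert, mem_singleton] at hj
    rcases hj with rfl | rfl
    · exact ⟨f, h, h24, hij⟩
    · refine ⟨_, h.comp _ s78, ?_⟩
      have e2 : Equiv.swap (7 : ZMod 9) 8 2 = 2 := by decide
      have e4 : Equiv.swap (7 : ZMod 9) 8 4 = 4 := by decide
      have e5 : Equiv.swap (7 : ZMod 9) 8 5 = 5 := by decide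
      have e8 : Equiv.addRight (3 : ZMod 9) 5 = 8 := by decide
      simpa [e2, e4, e5, h24, e8] using hij
  obtain ⟨f, h, h24, h57⟩ := step2
  obtain ⟨i, hi, j, hj, hij⟩ := (h.comp _ r6).exists_adj hA
  have hi' : Equiv.addRight (6 : ZMod 9) i ∈ ({7, 8} : Finset (ZMod 9)) := by
    clear hij
    revert i; decide
  have hj' : Equiv.addRight (6 : ZMod 9) j ∈ ({1, 2} : Finset (ZMod 9)) := by
    clear hij
    revert j; decide
  simp only [Function.comp_apply] at hij
  generalize Equiv.addRight (6 : ZMod 9) i = k at hij hi'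
  generalize Equiv.addRight (6 : ZMod 9) j = l at hij hj'
  have hk : k = 8 := by
    simp only [mem_insert, mem_singleton] at hi'
    rcases hi' with rfl | rfl
    · exfalso
      have h5 := h.card_le hA (i := 7) (S := {6, 8, 0, 5, l}) (by
        intro m hm
        simp only [mem_insert, mem_singleton] at hm
        rcases hm with rfl | rfl | rfl | rfl | rfl
        · exact h.adj _ _ (by decide)
        · exact h.adj _ _ (by decide)
        · exact h.adj _ _ (by decide)
        · exact h57.symm
        · exact hij)
      clear hij
      revert l; decide
    · rfl
  subst hk
  have hl : l = 1 := by
    simp only [mem_insert, mem_singleton] at hj'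
    rcases hj' with rfl | rfl
    · rfl
    · exfalso
      have h5 := h.card_le hA (i := 2) (S := {0, 1, 3, 4, 8}) (by
        intro m hm
        simp only [mem_insert, mem_singleton] at hm
        rcases hm with rfl | rfl | rfl | rfl | rfl
        · exact h.adj _ _ (by decide)
        · exact h.adj _ _ (by decide)
        · exact h.adj _ _ (by decide)
        · exact h24
        · exact hij.symm)
      revert h5; decide
  subst hl
  exact hA.not_exc (Or.inr (h.isCopyY hA h24 h57 hij))

/-! ### Assembling the chain and excluding minimal counterexamples -/

/-- The degree bound gives `c ≁ d`. By `Critical.false_of_two_outer`, `d` has two outer neighbours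
not adjacent to `c`, so `N(v) = {y, z, p, q}`. Applying `Critical.adj_and_closed_of_two_outer` at
both ends closes up the chain. -/
theorem Critical.false_of_end {A H : Finset V} (hA : Critical G A) {v : V} (hv : v ∈ A)
    (hv4 : #(nbrs G A v) = 4) (hH : ExcComp G (A \ closedNbrs G A v) H) {a b c d y z : V}
    (hab : G.Adj a b) (hac : G.Adj a c) (had : G.Adj a d) (hbc : G.Adj b c) (hbd : G.Adj b d)
    (hcd : c ≠ d) (hHeq : H = {a, b, c, d}) (hy : y ∈ A) (hz : z ∈ A) (hyH : y ∉ H) (hzH : z ∉ H)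
    (hyz : y ≠ z) (hcy : G.Adj c y) (hcz : G.Adj c z) : False := by
  have hHN : ∀ h ∈ H, h ∈ A ∧ h ∉ closedNbrs G A v := fun h hh => mem_sdiff.1 (hH.closed.1 hh)
  have hHd : IsDiamondSet G H := hHeq ▸ IsDiamondSet.of_adj hab hac had hbc hbd hcd
  have haH : a ∈ H := by simp [hHeq]
  have hbH : b ∈ H := by simp [hHeq]
  have hcH : c ∈ H := by simp [hHeq]
  have hdH : d ∈ H := by simp [hHeq]
  have hne : ∀ {h x}, h ∈ H → x ∉ H → h ≠ x := by
    rintro h x hh hx rfl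
    exact hx hh
  have nc := eq_of_adj_of_card_le_four (hA.card_nbrs_le_four (hHN c hcH).1)
    ⟨(hHN a haH).1, hac.symm⟩ ⟨(hHN b hbH).1, hbc.symm⟩ ⟨hy, hcy⟩ ⟨hz, hcz⟩ hab.ne (hne haH hyH)
    (hne haH hzH) (hne hbH hyH) (hne hbH hzH) hyz
  have hcd' : ¬ G.Adj c d := by
    intro h
    rcases nc d (hHN d hdH).1 h with h | h | h | h
    · exact had.ne' h
    · exact hbd.ne' h
    · exact hne hdH hyH h
    · exact hne hdH hzH h
  have hex : ∃ p q, p ∈ A ∧ q ∈ A ∧ p ∉ H ∧ q ∉ H ∧ p ≠ q ∧ ¬ G.Adj c p ∧ ¬ G.Adj c q ∧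
      G.Adj d p ∧ G.Adj d q := by
    by_contra! hcon
    refine hA.false_of_two_outer hv hv4 hH hHd hcH hy hz hyH hzH hyz hcy hcz ?_
    intro u hu huc hcu p hp q hq hcp hcq hup huq
    have hud : u = d := by
      rw [hHeq] at hu
      simp only [mem_insert, mem_singleton] at hu
      rcases hu with rfl | rfl | rfl | rfl
      · exact (hcu hac.symm).elim
      · exact (hcu hbc.symm).elim
      · exact (huc rfl).elim
      · rfl
    subst hud
    have hnot : ∀ p, ¬ G.Adj c p → G.Adj u p → p ∉ H := by
      intro p hcp hup hpH
      rw [hHeq] at hpH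
      simp only [mem_insert, mem_singleton] at hpH
      rcases hpH with rfl | rfl | rfl | rfl
      · exact hcp hac.symm
      · exact hcp hbc.symm
      · exact hcd' hup.symm
      · exact hup.ne rfl
    by_contra hpq
    exact hcon p q hp hq (hnot p hcp hup) (hnot q hcq huq) hpq hcp hcq hup huq
  obtain ⟨p, q, hp, hq, hpH, hqH, hpq, hcp, hcq, hdp, hdq⟩ := hex
  have nd := eq_of_adj_of_card_le_four (hA.card_nbrs_le_four (hHN d hdH).1)
    ⟨(hHN a haH).1, had.symm⟩ ⟨(hHN b hbH).1, hbd.symm⟩ ⟨hp, hdp⟩ ⟨hq, hdq⟩ hab.ne (hne haH hpH)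
    (hne haH hqH) (hne hbH hpH) (hne hbH hqH) hpq
  have hyp : y ≠ p := by rintro rfl; contradiction
  have hyq : y ≠ q := by rintro rfl; contradiction
  have hzp : z ≠ p := by rintro rfl; contradiction
  have hzq : z ≠ q := by rintro rfl; contradiction
  have hdy : ¬ G.Adj d y := by
    intro h
    rcases nd y hy h with h | h | h | h
    exacts [hne haH hyH h.symm, hne hbH hyH h.symm, hyp h, hyq h]
  have hdz : ¬ G.Adj d z := by
    intro h
    rcases nd z hz h with h | h | h | h
    exacts [hne haH hzH h.symm, hne hbH hzH h.symm, hzp h, hzq h]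
  have hN : ∀ {t x}, t ∈ H → x ∈ A → x ∉ H → G.Adj t x → x ∈ nbrs G A v := fun ht hx hxH h =>
    links_subset ((hH.closed.mem_or_mem_links ht hx h).resolve_left hxH)
  have hyN := hN hcH hy hyH hcy
  have hzN := hN hcH hz hzH hcz
  have hpN := hN hdH hp hpH hdp
  have hqN := hN hdH hq hqH hdq
  have hvy := (mem_nbrs.1 hyN).2
  have hvz := (mem_nbrs.1 hzN).2
  have hvp := (mem_nbrs.1 hpN).2
  have hvq := (mem_nbrs.1 hqN).2
  have hvH : v ∉ H := fun h => (hHN v h).2 (by simp)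
  have nv := eq_of_adj_of_card_le_four hv4.le ⟨hy, hvy⟩ ⟨hz, hvz⟩ ⟨hp, hvp⟩ ⟨hq, hvq⟩ hyz hyp hyq
    hzp hzq hpq
  obtain ⟨h34, hcl34⟩ := hA.adj_and_closed_of_two_outer hv hH hHeq hab.ne hac hbc hcd hcd' hyN hzN
    hpN hqN hyz hpq hcy hcz hdp hdq hcp hcq
  obtain ⟨h12, hcl12⟩ := hA.adj_and_closed_of_two_outer hv hH (c := d) (d := c)
    (hHeq.trans (by rw [pair_comm c d])) hab.ne had hbd hcd.symm (fun h => hcd' h.symm) hpN hqN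
    hyN hzN hpq hyz hdp hdq hcy hcz hdy hdz
  have hAeq := hA.eq_closedNbrs_union hv hH (by
    intro x hx
    obtain ⟨hxA, hvx⟩ := mem_nbrs.1 hx
    rcases nv x hxA hvx with rfl | rfl | rfl | rfl
    · exact hcl12 _ (Or.inl rfl)
    · exact hcl12 _ (Or.inr rfl)
    · exact hcl34 _ (Or.inl rfl)
    · exact hcl34 _ (Or.inr rfl))
  -- The cyclic order: the junctions `v`, `d`, `c` have indices `0`, `3`, `6`, and the middle pairs
  -- lie between them.
  have hinj : Function.Injective (![v, p, q, d, b, a, c, y, z] : Fin 9 → V) := by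
    simp only [Matrix.vecCons, Fin.cons_injective_iff, Set.mem_range, not_exists, Fin.forall_fin_succ,
      Fin.cons_zero, Fin.cons_succ]
    simp [hvy.ne', hvz.ne', hvp.ne', hvq.ne', hab.ne, hac.ne', had.ne, hbc.ne', hbd.ne, hcd, hyz.symm,
      hpq.symm, hyp, hyq, hzp, hzq, hne haH hvH, hne hbH hvH, hne hcH hvH, hne hdH hvH, hne haH
      hpH, hne hbH hpH, hne hcH hpH, hne hdH hpH, hne haH hqH, hne hbH hqH, hne hcH hqH, hne hdH
      hqH, (hne haH hyH).symm, (hne hbH hyH).symm, (hne hcH hyH).symm, (hne hdH hyH).symm, (hne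
      haH hzH).symm, (hne hbH hzH).symm, (hne hcH hzH).symm, (hne hdH hzH).symm,
      Function.injective_of_subsingleton]
  have hchain : IsDiamondChain G A (![v, p, q, d, b, a, c, y, z] : Fin 9 → V) := by
    refine ⟨hinj, ?_, ?_⟩
    · refine subset_antisymm (fun x hx => ?_) (fun x hx => ?_)
      · obtain ⟨i, -, rfl⟩ := mem_image.1 hx
        clear hx
        revert i
        exact Fin.forall_fin_succ.2 ⟨hv, Fin.forall_fin_succ.2 ⟨hp, Fin.forall_fin_succ.2 ⟨hq,
          Fin.forall_fin_succ.2 ⟨(hHN d hdH).1, Fin.forall_fin_succ.2 ⟨(hHN b hbH).1,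
          Fin.forall_fin_succ.2 ⟨(hHN a haH).1, Fin.forall_fin_succ.2 ⟨(hHN c hcH).1,
          Fin.forall_fin_succ.2 ⟨hy, Fin.forall_fin_succ.2 ⟨hz, fun i => i.elim0⟩⟩⟩⟩⟩⟩⟩⟩⟩
      · rw [hAeq] at hx
        refine mem_image.2 ?_
        rcases mem_union.1 hx with hx | hx
        · rcases mem_closedNbrs.1 hx with rfl | ⟨hxA, hvx⟩
          · exact ⟨(0 : Fin 9), mem_univ _, rfl⟩
          · rcases nv x hxA hvx with rfl | rfl | rfl | rfl
            exacts [⟨(7 : Fin 9), mem_univ _, rfl⟩, ⟨(8 : Fin 9), mem_univ _, rfl⟩,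
              ⟨(1 : Fin 9), mem_univ _, rfl⟩, ⟨(2 : Fin 9), mem_univ _, rfl⟩]
        · rw [hHeq] at hx
          simp only [mem_insert, mem_singleton] at hx
          rcases hx with rfl | rfl | rfl | rfl
          exacts [⟨(5 : Fin 9), mem_univ _, rfl⟩, ⟨(4 : Fin 9), mem_univ _, rfl⟩,
            ⟨(6 : Fin 9), mem_univ _, rfl⟩, ⟨(3 : Fin 9), mem_univ _, rfl⟩]
    · have hsymm : ∀ i j : ZMod 9, ChainAdj i j → (i, j) ∈ ({(0, 1), (0, 2), (0, 7), (0, 8), (1, 2),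
          (1, 3), (2, 3), (3, 4), (3, 5), (4, 5), (4, 6), (5, 6), (6, 7), (6, 8), (7, 8)} :
            Finset (ZMod 9 × ZMod 9)) ∨ (j, i) ∈ ({(0, 1), (0, 2), (0, 7), (0, 8), (1, 2),
          (1, 3), (2, 3), (3, 4), (3, 5), (4, 5), (4, 6), (5, 6), (6, 7), (6, 8), (7, 8)} :
            Finset (ZMod 9 × ZMod 9)) := by decide
      have hadj : ∀ i j : ZMod 9, (i, j) ∈ ({(0, 1), (0, 2), (0, 7), (0, 8), (1, 2),
          (1, 3), (2, 3), (3, 4), (3, 5), (4, 5), (4, 6), (5, 6), (6, 7), (6, 8), (7, 8)} :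
            Finset (ZMod 9 × ZMod 9)) → G.Adj ((![v, p, q, d, b, a, c, y, z] : Fin 9 → V) i)
              ((![v, p, q, d, b, a, c, y, z] : Fin 9 → V) j) := by
        intro i j hij
        simp only [mem_insert, mem_singleton, Prod.mk.injEq] at hij
        rcases hij with ⟨rfl, rfl⟩ | ⟨rfl, rfl⟩ | ⟨rfl, rfl⟩ | ⟨rfl, rfl⟩ | ⟨rfl, rfl⟩ | ⟨rfl, rfl⟩ |
          ⟨rfl, rfl⟩ | ⟨rfl, rfl⟩ | ⟨rfl, rfl⟩ | ⟨rfl, rfl⟩ | ⟨rfl, rfl⟩ | ⟨rfl, rfl⟩ | ⟨rfl, rfl⟩ |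
          ⟨rfl, rfl⟩ | ⟨rfl, rfl⟩
        exacts [hvp, hvq, hvy, hvz, h34, hdp.symm, hdq.symm, hbd.symm, had.symm, hab.symm, hbc, hac,
          hcy, hcz, h12]
      intro i j hij
      rcases hsymm i j hij with h | h
      · exact hadj i j h
      · exact (hadj j i h).symm
  exact hchain.false hA

theorem not_critical (A : Finset V) : ¬ Critical G A := by
  intro hA
  obtain ⟨v, hv, h4⟩ := hA.exists_four_le_card_nbrs
  have hv4 := le_antisymm (hA.card_nbrs_le_four hv) h4
  obtain ⟨H, hH, hHd⟩ := hA.exists_excComp_of_card_nbrs hv hv4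
  obtain ⟨t, ht, y, hy, z, hz, hyH, hzH, hyz, hty, htz⟩ := hA.exists_two_outer hv hv4 hH hHd
  obtain ⟨a, b, c, d, hab, hac, had, hbc, hbd, hcd, hHeq⟩ := hHd
  have hHA : H ⊆ A := hH.closed.1.trans sdiff_subset
  -- A hub of `H` cannot have two outer neighbours, since its degree would be at least 5; hence `t`
  -- is an end.
  have hmid : ∀ p q r, p ∈ H → q ∈ H → r ∈ H → p ≠ q → p ≠ r → q ≠ r → G.Adj t p → G.Adj t q →
      G.Adj t r → False := by
    intro p q r hp hq hr hpq hpr hqr htp htq htr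
    rcases eq_of_adj_of_card_le_four (hA.card_nbrs_le_four (hHA ht)) ⟨hHA hp, htp⟩ ⟨hHA hq, htq⟩
      ⟨hHA hr, htr⟩ ⟨hy, hty⟩ hpq hpr (by rintro rfl; contradiction) hqr
      (by rintro rfl; contradiction) (by rintro rfl; contradiction) z hz htz with h | h | h | h
    · exact hzH (h ▸ hp)
    · exact hzH (h ▸ hq)
    · exact hzH (h ▸ hr)
    · exact hyz h.symm
  have haH : a ∈ H := by simp [hHeq]
  have hbH : b ∈ H := by simp [hHeq]
  have hcH : c ∈ H := by simp [hHeq]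
  have hdH : d ∈ H := by simp [hHeq]
  have ht' := ht
  rw [hHeq] at ht'
  simp only [mem_insert, mem_singleton] at ht'
  rcases ht' with rfl | rfl | rfl | rfl
  · exact hmid b c d hbH hcH hdH hbc.ne hbd.ne hcd hab hac had
  · exact hmid a c d haH hcH hdH hac.ne had.ne hcd hab.symm hbc hbd
  · exact hA.false_of_end hv hv4 hH hab hac had hbc hbd hcd hHeq hy hz hyH hzH hyz hty htz
  · exact hA.false_of_end hv hv4 hH hab had hac hbd hbc hcd.symm
      (hHeq.trans (by rw [pair_comm c t])) hy hz hyH hzH hyz hty htz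

theorem IsConn.exceptional_or_good {A : Finset V} (hA : IsConn G A) : Exceptional G A ∨ Good G A := by
  induction A using Finset.strongInduction with
  | H A ih =>
  by_contra! h
  exact not_critical A ⟨hA, h.1, h.2, fun C hC hCc => ih C hC hCc⟩

/-! ### Translation to the statement about graphs -/

theorem isConn_univ [Fintype V] (hG : G.Connected) : IsConn G univ := by
  have := hG.nonempty
  refine ⟨univ_nonempty, fun C ⟨x, hx⟩ hC => eq_univ_iff_forall.2 fun y => ?_⟩
  obtain ⟨w⟩ := hG.preconnected x y
  induction w with
  | nil => exact hx
  | cons h _ ih => exact ih (hC.2 _ hx _ (mem_univ _) h)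

theorem Isolates.isIsolatingSet [Fintype V] {S : Finset V} (h : Isolates G univ S) :
    IsIsolatingSet G diamond (S : Set V) := by
  rintro ⟨f⟩
  have hadj : ∀ i j, diamond.Adj i j → G.Adj (f i) (f j) := fun i j hij => f.toHom.map_adj hij
  have hinj : Function.Injective f := f.injective
  have e : ∀ i j : Fin 4, diamond.Adj i j ↔ (i ≠ j ∧ s(i, j) ≠ s(0, 1)) := by
    intro i j
    simp [diamond]
  -- In `diamond` the missing edge is `{0, 1}`, so the hubs are `2` and `3`.
  obtain ⟨q, hq, hqc⟩ := h {(f 2 : V), (f 3 : V), (f 0 : V), (f 1 : V)} (subset_univ _)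
    (IsDiamondSet.of_adj (hadj _ _ ((e _ _).2 (by decide))) (hadj _ _ ((e _ _).2 (by decide)))
      (hadj _ _ ((e _ _).2 (by decide))) (hadj _ _ ((e _ _).2 (by decide)))
      (hadj _ _ ((e _ _).2 (by decide))) fun h => by
        have := hinj (Subtype.ext h)
        simp at this)
  have hout : ∀ i, ¬ Covers G S (f i) := fun i hi => (f i).2 (by
    simpa [closedNeighborhood, Covers] using hi)
  simp only [mem_insert, mem_singleton] at hq
  rcases hq with rfl | rfl | rfl | rfl <;> exact hout _ hqc

/-- A spanning subgraph isomorphic to the diamond forces `B₂` or `K₄`. -/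
theorem IsDiamondSet.nonempty_iso [Fintype V] (h : IsDiamondSet G univ) :
    Nonempty (G ≃g diamond) ∨ Nonempty (G ≃g (⊤ : SimpleGraph (Fin 4))) := by
  have hcard := h.card
  obtain ⟨a, b, c, d, hab, hac, had, hbc, hbd, hcd, heq⟩ := h
  have hinj : Function.Injective (![c, d, a, b] : Fin 4 → V) := by
    simp only [Matrix.vecCons, Fin.cons_injective_iff, Set.mem_range, not_exists,
      Fin.forall_fin_succ, Fin.cons_zero, Fin.cons_succ]
    simp [hcd.symm, hac.ne, had.ne, hbc.ne, hbd.ne, hab.ne', Function.injective_of_subsingleton]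
  have hbij : Function.Bijective (![c, d, a, b] : Fin 4 → V) := by
    rw [Fintype.bijective_iff_injective_and_card]
    exact ⟨hinj, by rw [← card_univ (α := V), hcard]; rfl⟩
  by_cases h : G.Adj c d
  · right
    refine ⟨(RelIso.symm ⟨Equiv.ofBijective _ hbij, ?_⟩)⟩
    intro i j
    fin_cases i <;> fin_cases j <;>
      simp [hab, hac, had, hbc, hbd, h, hab.symm, hac.symm, had.symm, hbc.symm, hbd.symm, h.symm]
  · left
    have h' : ¬ G.Adj d c := fun h' => h h'.symm
    refine ⟨(RelIso.symm ⟨Equiv.ofBijective _ hbij, ?_⟩)⟩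
    intro i j
    fin_cases i <;> fin_cases j <;>
      simp [diamond, hab, hac, had, hbc, hbd, h, h', hab.symm, hac.symm, had.symm, hbc.symm,
        hbd.symm]

theorem IsCopyY.nonempty_iso [Fintype V] (h : IsCopyY G univ) : Nonempty (G ≃g graphY) := by
  obtain ⟨f, hf, hs, hadj⟩ := h
  have hbij : Function.Bijective f := ⟨hf, fun y => by
    have := mem_univ y
    rw [← hs] at this
    obtain ⟨i, -, hi⟩ := mem_image.1 this
    exact ⟨i, hi⟩⟩
  exact ⟨RelIso.symm ⟨Equiv.ofBijective f hbij, fun {i j} => hadj i j⟩⟩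

end DiamondIsolation

theorem theorem1 {V : Type*} [Fintype V] (G : SimpleGraph V) (hG : G.Connected) :
    ((¬ Nonempty (G ≃g DiamondIsolation.diamond)) →
      (¬ Nonempty (G ≃g (⊤ : SimpleGraph (Fin 4)))) →
      (¬ Nonempty (G ≃g DiamondIsolation.graphY)) →
        (∃ S : Finset V,
          DiamondIsolation.IsIsolatingSet G DiamondIsolation.diamond (S : Set V) ∧
            (S.card : ℝ) ≤ (Fintype.card V : ℝ) / 5) ∧
        (DiamondIsolation.isolationNumber G DiamondIsolation.diamond : ℝ) ≤
          (Fintype.card V : ℝ) / 5) ∧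
    (10 ≤ Fintype.card V →
        (∃ S : Finset V,
          DiamondIsolation.IsIsolatingSet G DiamondIsolation.diamond (S : Set V) ∧
            (S.card : ℝ) ≤ (Fintype.card V : ℝ) / 5) ∧
        (DiamondIsolation.isolationNumber G DiamondIsolation.diamond : ℝ) ≤
          (Fintype.card V : ℝ) / 5) := by
  have key : (¬ Nonempty (G ≃g DiamondIsolation.diamond)) →
      (¬ Nonempty (G ≃g (⊤ : SimpleGraph (Fin 4)))) →
      (¬ Nonempty (G ≃g DiamondIsolation.graphY)) →
        (∃ S : Finset V,
          DiamondIsolation.IsIsolatingSet G DiamondIsolation.diamond (S : Set V) ∧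
            (S.card : ℝ) ≤ (Fintype.card V : ℝ) / 5) ∧
        (DiamondIsolation.isolationNumber G DiamondIsolation.diamond : ℝ) ≤
          (Fintype.card V : ℝ) / 5 := by
    intro h1 h2 h3
    obtain ⟨S, -, hS, hiso⟩ :=
      ((DiamondIsolation.isConn_univ hG).exceptional_or_good).resolve_left (by
        rintro (h | h)
        · exact h.nonempty_iso.elim h1 h2
        · exact h3 h.nonempty_iso)
    have hS' : (S.card : ℝ) ≤ (Fintype.card V : ℝ) / 5 := by
      have : ((5 * S.card : ℕ) : ℝ) ≤ (Fintype.card V : ℝ) := by exact_mod_cast hS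
      push_cast at this
      linarith
    refine ⟨⟨S, hiso.isIsolatingSet, hS'⟩, le_trans ?_ hS'⟩
    have : DiamondIsolation.isolationNumber G DiamondIsolation.diamond ≤ S.card :=
      Nat.sInf_le ⟨S, hiso.isIsolatingSet, rfl⟩
    exact_mod_cast this
  -- The three excluded graphs have orders 4, 4 and 9, all less than 10.
  refine ⟨key, fun h10 => key ?_ ?_ ?_⟩ <;> rintro ⟨e⟩ <;>
    have := Fintype.card_congr e.toEquiv <;> simp [ZMod.card] at this <;> omega
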